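/- Let $\theta>1$, $\lambda>0$, $\sigma\neq 0$ and $0\le\alpha<2$, and put $\lambda(x)=\lambda/|x|^{\alpha}$ for $x\ne 0$. Let $p:\mathbb R\to[0,\infty)$ be a probability density that is continuous on $\mathbb R$, of class $C^2$ on $\mathbb R\setminus\{0\}$, and satisfies the non-local equation $$\sigma^2 p''(x)=2\lambda(x)\,p(x)-2\theta\,\lambda(\theta x)\,p(\theta x)\qquad\text{for all }x\neq 0 .$$ Then for every $x\ne 0$ the following series converges absolutely and $$p(x)=2\phi\,(2-\alpha)\sum_{n=0}^{\infty}\frac{a_n}{\theta^{n}}\sqrt{\Big(\tfrac{2\lambda}{\sigma^2(2-\alpha)^2}\Big)^{\frac1{2-\alpha}}\theta^{n}|x|}\;\,K_{\frac{1}{2-\alpha}}\!\left(2\sqrt{\frac{2\lambda\,\theta^{n(2-\alpha)}|x|^{2-\alpha}}{\sigma^2(2-\alpha)^2}}\right),$$ where $$a_0=1,\qquad a_n=\prod_{k=1}^{n}\frac{\theta^{2-\alpha}}{1-\theta^{k(2-\alpha)}},\qquad \phi=\frac{\Big(\frac{2\lambda}{\sigma^2(2-\alpha)^2}\Big)^{\frac1{2-\alpha}}}{2\,\Gamma\!\big(\frac1{2-\alpha}\big)\Gamma\!\big(\frac2{2-\alpha}\big)}\left(\prod_{k=0}^{\infty}\Big(1-\frac1{\theta^{2+k(2-\alpha)}}\Big)\right)^{-1},$$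 and, for $\nu>0$ and $z>0$, $$K_\nu(z)=\frac{\Gamma(\nu+\frac12)(2z)^\nu}{\sqrt\pi}\int_0^\infty\frac{\cos t}{(t^2+z^2)^{\nu+\frac12}}\,dt$$ is the modified Bessel function of the second kind. (The value $p(0)$ is determined by continuity.) -/

import Mathlib

namespace WeakConsensus

/-- `p` is a probability density on the real line. -/
structure IsDensity (p : ℝ → ℝ) : Prop where
  nonneg : ∀ x, 0 ≤ p x
  integrable : MeasureTheory.Integrable p
  integral_eq_one : ∫ x, p x = 1

/-- Power-law interaction rate `λ(x) = λ / |x| ^ α`; for `α = 0` it is the constant `λ`. -/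
noncomputable def powerLawRate (lam α x : ℝ) : ℝ := lam / |x| ^ α

/-- The stationary non-local equation
`σ² p'' - 2 μ p' = 2 λ(x) p(x) - 2 θ λ(θ x) p(θ x)`, at all points `x ≠ 0` (the rate is infinite
at the origin when it is a power law of positive exponent). -/
def SolvesStationaryODE (σ μ θ : ℝ) (rate p : ℝ → ℝ) : Prop :=
  ∀ x : ℝ, x ≠ 0 →
    σ ^ 2 * deriv (deriv p) x - 2 * μ * deriv p x
      = 2 * rate x * p x - 2 * θ * rate (θ * x) * p (θ * x)

/-- The modified Bessel function of the second kind, for `z > 0` and `ν > 0`, through its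
cosine integral. -/
noncomputable def besselK (ν z : ℝ) : ℝ :=
  Real.Gamma (ν + 1 / 2) * (2 * z) ^ ν / Real.sqrt Real.pi
    * ∫ t in Set.Ioi (0 : ℝ), Real.cos t / (t ^ 2 + z ^ 2) ^ (ν + 1 / 2)

/-- The coefficients `a_n = ∏_{k=1}^n θ^(2-α) / (1 - θ^(k(2-α)))`, with `a_0 = 1`. -/
noncomputable def coeff (θ α : ℝ) (n : ℕ) : ℝ :=
  ∏ k ∈ Finset.Icc 1 n, θ ^ (2 - α) / (1 - θ ^ ((k : ℝ) * (2 - α)))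

/-- The normalising constant `φ`. -/
noncomputable def normConst (σ lam θ α : ℝ) : ℝ :=
  (2 * lam / (σ ^ 2 * (2 - α) ^ 2)) ^ (1 / (2 - α))
      / (2 * Real.Gamma (1 / (2 - α)) * Real.Gamma (2 / (2 - α)))
    * (∏' k : ℕ, (1 - 1 / θ ^ (2 + (k : ℝ) * (2 - α))))⁻¹

/-- The `n`-th term of the Bessel series, without the common factor `2 φ (2 - α)`. -/
noncomputable def seriesTerm (σ lam θ α x : ℝ) (n : ℕ) : ℝ :=
  coeff θ α n / θ ^ n
    * Real.sqrt ((2 * lam / (σ ^ 2 * (2 - α) ^ 2)) ^ (1 / (2 - α)) * θ ^ n * |x|)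
    * besselK (1 / (2 - α))
        (2 * Real.sqrt (2 * lam * θ ^ ((n : ℝ) * (2 - α)) * |x| ^ (2 - α)
          / (σ ^ 2 * (2 - α) ^ 2)))

/-- The infinite product in `normConst` converges. -/
theorem multipliable_normConst {θ α : ℝ} (hθ : 1 < θ) (hα : α < 2) :
    Multipliable (fun k : ℕ => 1 - 1 / θ ^ (2 + (k : ℝ) * (2 - α))) := by
  have h0 : 0 < θ := by linarith
  have hq : θ ^ (-(2 - α)) < 1 := Real.rpow_lt_one_of_one_lt_of_neg hθ (by linarith)
  have hs : Summable (fun k : ℕ => θ ^ (-2 : ℝ) * (θ ^ (-(2 - α))) ^ k) :=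
    (summable_geometric_of_lt_one (Real.rpow_nonneg h0.le _) hq).mul_left _
  have he : ∀ k : ℕ, θ ^ (-2 : ℝ) * (θ ^ (-(2 - α))) ^ k
      = 1 / θ ^ (2 + (k : ℝ) * (2 - α)) := by
    intro k
    rw [← Real.rpow_natCast, ← Real.rpow_mul h0.le, ← Real.rpow_add h0, one_div,
      ← Real.rpow_neg h0.le]
    congr 1
    ring
  have hs' : Summable (fun k : ℕ => 1 / θ ^ (2 + (k : ℝ) * (2 - α))) := by
    simpa only [he] using hs
  have := Real.multipliable_one_add_of_summable hs'.neg
  simpa [sub_eq_add_neg] using this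

/-- The integral in `besselK` converges absolutely. -/
theorem integrableOn_besselK {ν z : ℝ} (hν : 0 < ν) (hz : 0 < z) :
    MeasureTheory.IntegrableOn
      (fun t : ℝ => Real.cos t / (t ^ 2 + z ^ 2) ^ (ν + 1 / 2)) (Set.Ioi 0) := by
  have hpos : ∀ t : ℝ, 0 < t ^ 2 + z ^ 2 := fun t => by positivity
  have hcont : Continuous (fun t : ℝ => Real.cos t / (t ^ 2 + z ^ 2) ^ (ν + 1 / 2)) := by
    refine Real.continuous_cos.div ?_ fun t => (Real.rpow_pos_of_pos (hpos t) _).ne'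
    exact (by fun_prop : Continuous fun t : ℝ => t ^ 2 + z ^ 2).rpow_const
      fun t => Or.inl (hpos t).ne'
  rw [← Set.Ioc_union_Ioi_eq_Ioi (zero_le_one (α := ℝ))]
  refine MeasureTheory.IntegrableOn.union
    (hcont.integrableOn_Icc.mono_set Set.Ioc_subset_Icc_self) ?_
  have hi := integrableOn_Ioi_rpow_of_lt (a := -(2 * ν + 1)) (by linarith) zero_lt_one
  refine MeasureTheory.Integrable.mono' hi hcont.aestronglyMeasurable ?_
  refine (MeasureTheory.ae_restrict_iff' measurableSet_Ioi).2 (Filter.Eventually.of_forall ?_)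
  intro t ht
  have ht0 : (0 : ℝ) < t := lt_trans zero_lt_one ht
  have hb : t ^ (2 * ν + 1) ≤ (t ^ 2 + z ^ 2) ^ (ν + 1 / 2) := by
    calc t ^ (2 * ν + 1) = (t ^ 2) ^ (ν + 1 / 2) := by
          rw [← Real.rpow_natCast, ← Real.rpow_mul ht0.le]
          congr 1
          push_cast
          ring
      _ ≤ _ := Real.rpow_le_rpow (by positivity) (by nlinarith [sq_nonneg z]) (by linarith)
  have hp : 0 < t ^ (2 * ν + 1) := Real.rpow_pos_of_pos ht0 _
  rw [Real.norm_eq_abs, abs_div, abs_of_pos (Real.rpow_pos_of_pos (hpos t) _),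
    Real.rpow_neg ht0.le, ← one_div]
  exact div_le_div₀ zero_le_one (Real.abs_cos_le_one t) hp hb

end WeakConsensus

namespace WeakConsensus

open MeasureTheory ProbabilityTheory Set Filter Topology

/-- Two Borel measures on the line whose moment generating functions are finite and agree near the
origin are equal. -/
theorem measure_ext_of_lintegral_exp {μ ν : Measure ℝ} {r : ℝ} (hr : 0 < r)
    (h : ∀ t : ℝ, |t| < r →
      ∫⁻ x, ENNReal.ofReal (Real.exp (t * x)) ∂μ = ∫⁻ x, ENNReal.ofReal (Real.exp (t * x)) ∂ν)
    (hfin : ∀ t : ℝ, |t| < r → ∫⁻ x, ENNReal.ofReal (Real.exp (t * x)) ∂μ ≠ ⊤) : μ = ν := by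
  have hint : ∀ κ : Measure ℝ, (∀ t : ℝ, |t| < r →
      ∫⁻ x, ENNReal.ofReal (Real.exp (t * x)) ∂κ ≠ ⊤) →
      Ioo (-r) r ⊆ interior (integrableExpSet id κ) := by
    intro κ hκ
    refine interior_maximal (fun t ht => ?_) isOpen_Ioo
    refine (lintegral_ofReal_ne_top_iff_integrable (by fun_prop)
      (Eventually.of_forall fun x => (Real.exp_pos _).le)).1 (hκ t (abs_lt.2 ht))
  have hμ := hint μ hfin
  have hν := hint ν fun t ht => h t ht ▸ hfin t ht
  have h0 : |(0 : ℝ)| < r := by simpa using hr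
  have : IsFiniteMeasure μ := ⟨by simpa using (hfin 0 h0).lt_top⟩
  have hν0 := hfin 0 h0
  rw [h 0 h0] at hν0
  have : IsFiniteMeasure ν := ⟨by simpa using hν0.lt_top⟩
  have hmgf : ∀ t : ℝ, |t| < r → complexMGF id μ t = complexMGF id ν t := by
    intro t ht
    rw [complexMGF_ofReal, complexMGF_ofReal, mgf, mgf,
      integral_eq_lintegral_of_nonneg_ae (Eventually.of_forall fun x => (Real.exp_pos _).le)
        (by fun_prop),
      integral_eq_lintegral_of_nonneg_ae (Eventually.of_forall fun x => (Real.exp_pos _).le)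
        (by fun_prop)]
    exact congrArg (fun y : ENNReal => (y.toReal : ℂ)) (h t ht)
  have hpre : IsPreconnected {z : ℂ | z.re ∈ Ioo (-r) r} :=
    ((convex_Ioo (-r) r).linear_preimage Complex.reLm).isPreconnected
  have heq : EqOn (complexMGF id μ) (complexMGF id ν) {z : ℂ | z.re ∈ Ioo (-r) r} := by
    refine AnalyticOnNhd.eqOn_of_preconnected_of_frequently_eq (z₀ := ((0 : ℝ) : ℂ))
      (analyticOnNhd_complexMGF.mono fun z hz => hμ hz)
      (analyticOnNhd_complexMGF.mono fun z hz => hν hz) hpre (by simpa using hr) ?_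
    have hreal : ∃ᶠ x : ℝ in 𝓝[≠] 0, complexMGF id μ x = complexMGF id ν x := by
      refine Eventually.frequently (eventually_nhdsWithin_of_eventually_nhds ?_)
      filter_upwards [Ioo_mem_nhds (neg_lt_zero.2 hr) hr] with t ht using hmgf t (abs_lt.2 ht)
    rw [frequently_iff_seq_forall] at hreal ⊢
    obtain ⟨xs, hx, hxe⟩ := hreal
    refine ⟨fun n => xs n, ?_, hxe⟩
    rw [tendsto_nhdsWithin_iff] at hx ⊢
    exact ⟨Complex.continuous_ofReal.continuousAt.tendsto.comp hx.1, by simpa using hx.2⟩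
  refine Measure.ext_of_charFun (funext fun t => ?_)
  rw [← complexMGF_id_mul_I, ← complexMGF_id_mul_I]
  exact heq (by simpa using hr)

/-- Determinacy of the Stieltjes moment problem, in the variable `x ^ β`, under the growth condition
`m_k ≤ C R ^ k (2 k)!`. -/
theorem restrict_Ioi_eq_of_moments {β C R : ℝ} (hβ : 0 < β) (hR : 0 < R)
    {μ ν : Measure ℝ}
    (h : ∀ k : ℕ, ∫⁻ x in Ioi 0, ENNReal.ofReal (x ^ (k * β)) ∂μ
      = ∫⁻ x in Ioi 0, ENNReal.ofReal (x ^ (k * β)) ∂ν)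
    (hb : ∀ k : ℕ, ∫⁻ x in Ioi 0, ENNReal.ofReal (x ^ (k * β)) ∂μ
      ≤ ENNReal.ofReal (C * R ^ k * (2 * k).factorial)) :
    μ.restrict (Ioi 0) = ν.restrict (Ioi 0) := by
  set X : ℝ → ℝ := fun x => x ^ (β / 2) with hX
  have hXm : Measurable X := by fun_prop
  have hXm' : Measurable fun x => -X x := hXm.neg
  set S : Measure ℝ → Measure ℝ := fun κ =>
    (κ.restrict (Ioi 0)).map X + (κ.restrict (Ioi 0)).map (fun x => -X x) with hS
  have hexp : ∀ (κ : Measure ℝ) (t : ℝ), ∫⁻ x, ENNReal.ofReal (Real.exp (t * x)) ∂(S κ)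
      = ∑' k : ℕ, ENNReal.ofReal (2 * t ^ (2 * k) / (2 * k).factorial)
        * ∫⁻ x in Ioi 0, ENNReal.ofReal (x ^ (k * β)) ∂κ := by
    intro κ t
    have hm : Measurable fun x : ℝ => ENNReal.ofReal (Real.exp (t * x)) := by fun_prop
    rw [hS, lintegral_add_measure, lintegral_map hm hXm, lintegral_map hm hXm',
      ← lintegral_add_left (by fun_prop)]
    simp_rw [← lintegral_const_mul' _ _ ENNReal.ofReal_ne_top]
    rw [← lintegral_tsum (fun k => by fun_prop)]
    refine setLIntegral_congr_fun measurableSet_Ioi fun x hx => ?_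
    have hx0 : (0 : ℝ) < x := hx
    have hs : HasSum (fun k : ℕ => 2 * t ^ (2 * k) / (2 * k).factorial * x ^ (k * β))
        (Real.exp (t * X x) + Real.exp (t * -X x)) := by
      have := (Real.hasSum_cosh (t * X x)).mul_left 2
      rw [show Real.exp (t * X x) + Real.exp (t * -X x) = 2 * Real.cosh (t * X x) by
        rw [Real.cosh_eq, mul_neg]; ring]
      refine (funext fun k => ?_ : (fun k : ℕ => 2 * t ^ (2 * k) / (2 * k).factorial * x ^ (k * β))
        = fun k : ℕ => 2 * ((t * X x) ^ (2 * k) / (2 * k).factorial)) ▸ this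
      · have : X x ^ (2 * k) = x ^ (k * β) := by
          rw [hX, ← Real.rpow_natCast, ← Real.rpow_mul hx0.le]
          congr 1; push_cast; ring
        rw [mul_pow, this]; ring
    rw [← ENNReal.ofReal_add (Real.exp_pos _).le (Real.exp_pos _).le, ← hs.tsum_eq,
      ENNReal.ofReal_tsum_of_nonneg _ hs.summable]
    · refine tsum_congr fun k => ?_
      rw [ENNReal.ofReal_mul]
      have := Even.pow_nonneg (even_two_mul k) t
      positivity
    · intro k
      have := Even.pow_nonneg (even_two_mul k) t
      positivity
  have hSeq : S μ = S ν := by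
    refine measure_ext_of_lintegral_exp (r := 1 / Real.sqrt R) (by positivity) (fun t _ => ?_)
      fun t ht => ?_
    · rw [hexp, hexp]
      simp_rw [h]
    · rw [hexp]
      have ht2 : t ^ 2 * R < 1 := by
        have h1 : |t| * Real.sqrt R < 1 := (lt_div_iff₀ (Real.sqrt_pos.2 hR)).1 ht
        have h2 : (|t| * Real.sqrt R) ^ 2 < 1 := by
          rw [sq_lt_one_iff₀ (by positivity)]; exact h1
        rwa [mul_pow, sq_abs, Real.sq_sqrt hR.le] at h2
      have hg : Summable fun k : ℕ => 2 * C * (t ^ 2 * R) ^ k :=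
        (summable_geometric_of_lt_one (by positivity) ht2).mul_left _
      refine ne_top_of_le_ne_top hg.tsum_ofReal_ne_top (ENNReal.tsum_le_tsum fun k => ?_)
      refine (mul_le_mul_right (hb k) _).trans ?_
      have := Even.pow_nonneg (even_two_mul k) t
      rw [← ENNReal.ofReal_mul (by positivity)]
      refine ENNReal.ofReal_le_ofReal (le_of_eq ?_)
      have hf : ((2 * k).factorial : ℝ) ≠ 0 := by positivity
      field_simp
      rw [mul_pow, pow_mul]
      ring
  have hrec : ∀ κ : Measure ℝ,
      κ.restrict (Ioi 0) = ((S κ).restrict (Ioi 0)).map (fun x => x ^ (2 / β)) := by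
    intro κ
    have hpos : X ⁻¹' Ioi 0 ∩ Ioi 0 = Ioi 0 := by
      ext x; simp only [mem_inter_iff, mem_preimage, mem_Ioi, and_iff_right_iff_imp]
      exact fun hx => Real.rpow_pos_of_pos hx _
    have hneg : (fun x => -X x) ⁻¹' Ioi 0 ∩ Ioi 0 = ∅ := by
      ext x; simp only [mem_inter_iff, mem_preimage, mem_Ioi, mem_empty_iff_false, iff_false]
      rintro ⟨h1, h2⟩
      have : 0 < X x := Real.rpow_pos_of_pos h2 _
      linarith
    rw [hS, Measure.restrict_add, Measure.restrict_map hXm measurableSet_Ioi,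
      Measure.restrict_map hXm' measurableSet_Ioi,
      Measure.restrict_restrict (hXm measurableSet_Ioi),
      Measure.restrict_restrict (hXm' measurableSet_Ioi)]
    rw [hpos, hneg, Measure.restrict_empty, Measure.map_zero, add_zero,
      Measure.map_map (by fun_prop) hXm]
    conv_lhs => rw [← Measure.map_id (μ := κ.restrict (Ioi 0))]
    refine Measure.map_congr ((ae_restrict_iff' measurableSet_Ioi).2 (ae_of_all _ fun x hx => ?_))
    have hx0 : (0 : ℝ) < x := hx
    simp only [id, Function.comp, hX]
    rw [← Real.rpow_mul hx0.le, show β / 2 * (2 / β) = 1 by field_simp, Real.rpow_one]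
  rw [hrec μ, hrec ν, hSeq]

/-- The half-line cosine transform of a Gaussian. -/
theorem integral_Ioi_cos_mul_exp_neg_mul_sq {s : ℝ} (hs : 0 < s) :
    ∫ t in Ioi (0 : ℝ), Real.cos t * Real.exp (-(s * t ^ 2))
      = 1 / 2 * (Real.sqrt (Real.pi / s) * Real.exp (-1 / (4 * s))) := by
  have h1 := fourierIntegral_gaussian (b := (s : ℂ)) (by simpa using hs) 1
  have hint : Integrable fun x : ℝ => Complex.exp (Complex.I * 1 * x) * Complex.exp (-s * x ^ 2) := by
    refine (integrable_cexp_neg_mul_sq (b := (s : ℂ)) (by simpa using hs)).bdd_mul (c := 1)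
      (by fun_prop) (ae_of_all _ fun x => ?_)
    rw [Complex.norm_exp]; simp
  have h2 := congrArg Complex.re h1
  have h3 : (∫ x : ℝ, Complex.exp (Complex.I * 1 * x) * Complex.exp (-s * x ^ 2)).re
      = ∫ x : ℝ, Real.cos x * Real.exp (-(s * x ^ 2)) := by
    rw [← RCLike.re_eq_complex_re, ← integral_re hint]
    refine integral_congr_ae (ae_of_all _ fun x => ?_)
    have e1 : Complex.exp (-s * x ^ 2) = ((Real.exp (-(s * x ^ 2)) : ℝ) : ℂ) := by
      push_cast; ring_nf
    have e2 : Complex.exp (Complex.I * 1 * x) = Complex.exp (x * Complex.I) := by ring_nf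
    simp only [RCLike.re_eq_complex_re]
    rw [e1, e2, Complex.re_mul_ofReal, Complex.exp_ofReal_mul_I_re]
  have h4 : ((Real.pi / s : ℂ) ^ (1 / 2 : ℂ) * Complex.exp (-1 ^ 2 / (4 * s))).re
      = Real.sqrt (Real.pi / s) * Real.exp (-1 / (4 * s)) := by
    have e1 : (Real.pi / s : ℂ) ^ (1 / 2 : ℂ) = ((Real.sqrt (Real.pi / s) : ℝ) : ℂ) := by
      rw [Real.sqrt_eq_rpow, Complex.ofReal_cpow (by positivity)]
      push_cast; rfl
    have e2 : Complex.exp (-1 ^ 2 / (4 * s)) = ((Real.exp (-1 / (4 * s)) : ℝ) : ℂ) := by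
      push_cast; ring_nf
    rw [e1, e2, ← Complex.ofReal_mul, Complex.ofReal_re]
  rw [h3, h4] at h2
  have h5 := integral_comp_abs (f := fun x : ℝ => Real.cos x * Real.exp (-(s * x ^ 2)))
  simp only [Real.cos_abs, sq_abs] at h5
  rw [h5] at h2
  linarith

/-- The exponential integral representation of `K_ν`. -/
theorem besselK_eq_integral_exp {ν z : ℝ} (hν : 0 < ν) (hz : 0 < z) :
    besselK ν z = 1 / 2 * (2 / z) ^ ν
      * ∫ w in Ioi (0 : ℝ), w ^ (ν - 1) * Real.exp (-w - z ^ 2 / 4 / w) := by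
  have hν2 : 0 < ν + 1 / 2 := by linarith
  have hG : ∀ t : ℝ, ∫ s in Ioi (0 : ℝ), s ^ (ν + 1 / 2 - 1) * Real.exp (-((t ^ 2 + z ^ 2) * s))
      = Real.Gamma (ν + 1 / 2) / (t ^ 2 + z ^ 2) ^ (ν + 1 / 2) := by
    intro t
    have hp : 0 < t ^ 2 + z ^ 2 := by positivity
    rw [Real.integral_rpow_mul_exp_neg_mul_Ioi hν2 hp, Real.div_rpow zero_le_one hp.le,
      Real.one_rpow]
    ring
  have hGi : ∀ t : ℝ, IntegrableOn
      (fun s : ℝ => s ^ (ν + 1 / 2 - 1) * Real.exp (-((t ^ 2 + z ^ 2) * s))) (Ioi 0) := by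
    intro t
    have hp : 0 < t ^ 2 + z ^ 2 := by positivity
    by_contra hcon
    have := hG t
    rw [integral_undef hcon] at this
    have h1 := Real.Gamma_pos_of_pos hν2
    have h2 := Real.rpow_pos_of_pos hp (ν + 1 / 2)
    exact (div_pos h1 h2).ne this
  have hdom : IntegrableOn (fun t : ℝ => Real.Gamma (ν + 1 / 2) / (t ^ 2 + z ^ 2) ^ (ν + 1 / 2))
      (Ioi 0) := by
    have hi : Integrable fun t : ℝ => (1 + ‖t‖ ^ 2) ^ (-(2 * ν + 1) / 2) :=
      integrable_rpow_neg_one_add_norm_sq (by simpa using hν)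
    have hm : 0 < min 1 (z ^ 2) := lt_min one_pos (by positivity)
    refine Integrable.mono' ((hi.const_mul (Real.Gamma (ν + 1 / 2)
      * min 1 (z ^ 2) ^ (-(2 * ν + 1) / 2))).integrableOn)
      (Measurable.aestronglyMeasurable (by fun_prop)) (ae_of_all _ fun t => ?_)
    have h1 := Real.Gamma_pos_of_pos hν2
    have h2 : 0 < t ^ 2 + z ^ 2 := by positivity
    rw [Real.norm_of_nonneg (by positivity), mul_assoc, ← Real.mul_rpow hm.le (by positivity),
      div_eq_mul_inv, ← Real.rpow_neg h2.le, show -(2 * ν + 1) / 2 = -(ν + 1 / 2) by ring]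
    refine mul_le_mul_of_nonneg_left ?_ h1.le
    refine Real.rpow_le_rpow_of_nonpos (by positivity) ?_ (by linarith)
    rw [Real.norm_eq_abs, sq_abs, mul_add, mul_one, add_comm]
    exact add_le_add (mul_le_of_le_one_left (sq_nonneg t) (min_le_left _ _)) (min_le_right _ _)
  set F : ℝ → ℝ → ℝ := fun t s =>
    Real.cos t * (s ^ (ν + 1 / 2 - 1) * Real.exp (-((t ^ 2 + z ^ 2) * s))) with hF
  have hprod : Integrable (Function.uncurry F)
      ((volume.restrict (Ioi 0)).prod (volume.restrict (Ioi 0))) := by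
    rw [integrable_prod_iff (by
      refine Measurable.aestronglyMeasurable ?_
      simp only [hF, Function.uncurry_def]
      fun_prop)]
    refine ⟨ae_of_all _ fun t => (hGi t).const_mul (Real.cos t), ?_⟩
    refine Integrable.mono' hdom (by
      refine (Measurable.aestronglyMeasurable ?_ : AEStronglyMeasurable _ _).norm.integral_prod_right'
      simp only [hF, Function.uncurry_def]
      fun_prop) (ae_of_all _ fun t => ?_)
    rw [← hG t, Real.norm_of_nonneg (integral_nonneg fun _ => norm_nonneg _)]
    refine integral_mono_of_nonneg (ae_of_all _ fun _ => norm_nonneg _) (hGi t)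
      ((ae_restrict_iff' measurableSet_Ioi).2 (ae_of_all _ fun s hs => ?_))
    have hs0 : (0 : ℝ) < s := hs
    have : 0 < s ^ (ν + 1 / 2 - 1) * Real.exp (-((t ^ 2 + z ^ 2) * s)) :=
      mul_pos (Real.rpow_pos_of_pos hs0 _) (Real.exp_pos _)
    simp only [Function.uncurry_apply_pair, hF, norm_mul (Real.cos t)]
    rw [Real.norm_of_nonneg this.le, Real.norm_eq_abs]
    exact mul_le_of_le_one_left this.le (Real.abs_cos_le_one t)
  have hswap := integral_integral_swap hprod
  have hl : ∀ t : ℝ, ∫ s in Ioi (0 : ℝ), F t s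
      = Real.Gamma (ν + 1 / 2) * (Real.cos t / (t ^ 2 + z ^ 2) ^ (ν + 1 / 2)) := by
    intro t
    rw [hF, integral_const_mul, hG]
    ring
  have hr : ∀ s ∈ Ioi (0 : ℝ), ∫ t in Ioi (0 : ℝ), F t s
      = Real.sqrt Real.pi / 2 * (s ^ (ν - 1) * Real.exp (-(z ^ 2 * s) - 1 / (4 * s))) := by
    intro s hs
    have hs0 : (0 : ℝ) < s := hs
    have : ∀ t : ℝ, F t s = s ^ (ν + 1 / 2 - 1) * Real.exp (-(z ^ 2 * s))
        * (Real.cos t * Real.exp (-(s * t ^ 2))) := by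
      intro t
      have : Real.exp (-((t ^ 2 + z ^ 2) * s))
          = Real.exp (-(z ^ 2 * s)) * Real.exp (-(s * t ^ 2)) := by
        rw [← Real.exp_add]; ring_nf
      rw [hF]; simp only [this]; ring
    simp_rw [this]
    rw [integral_const_mul, integral_Ioi_cos_mul_exp_neg_mul_sq hs0, Real.sqrt_div Real.pi_pos.le,
      sub_eq_add_neg (-(z ^ 2 * s)), Real.exp_add, show ν + 1 / 2 - 1 = (ν - 1) + 1 / 2 by ring,
      Real.rpow_add hs0, ← Real.sqrt_eq_rpow, neg_div]
    have := (Real.sqrt_pos.2 hs0).ne'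
    field_simp
  simp_rw [hl] at hswap
  rw [setIntegral_congr_fun measurableSet_Ioi hr, integral_const_mul, integral_const_mul] at hswap
  have hsub := integral_comp_mul_left_Ioi
    (fun w : ℝ => w ^ (ν - 1) * Real.exp (-w - z ^ 2 / 4 / w)) 0 (b := z ^ 2) (by positivity)
  have hsub' : ∫ x in Ioi (0 : ℝ), (z ^ 2 * x) ^ (ν - 1)
        * Real.exp (-(z ^ 2 * x) - z ^ 2 / 4 / (z ^ 2 * x))
      = (z ^ 2) ^ (ν - 1) * ∫ s in Ioi (0 : ℝ), s ^ (ν - 1) * Real.exp (-(z ^ 2 * s) - 1 / (4 * s)) := by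
    rw [← integral_const_mul]
    refine setIntegral_congr_fun measurableSet_Ioi fun s hs => ?_
    have hs0 : (0 : ℝ) < s := hs
    have : z ^ 2 / 4 / (z ^ 2 * s) = 1 / (4 * s) := by field_simp
    simp only [this]
    rw [Real.mul_rpow (by positivity) hs0.le]; ring
  rw [hsub', mul_zero, smul_eq_mul] at hsub
  set J := ∫ w in Ioi (0 : ℝ), w ^ (ν - 1) * Real.exp (-w - z ^ 2 / 4 / w)
  set J' := ∫ s in Ioi (0 : ℝ), s ^ (ν - 1) * Real.exp (-(z ^ 2 * s) - 1 / (4 * s))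
  set C := ∫ t in Ioi (0 : ℝ), Real.cos t / (t ^ 2 + z ^ 2) ^ (ν + 1 / 2)
  have hJ : J = (z ^ 2) ^ ν * J' := by
    rw [Real.rpow_sub_one (by positivity)] at hsub
    have : z ^ 2 ≠ 0 := by positivity
    field_simp at hsub
    linarith
  have hz2 : (2 * z) ^ ν = (2 / z) ^ ν * (z ^ 2) ^ ν := by
    rw [← Real.mul_rpow (by positivity) (by positivity)]
    congr 1; field_simp
  have hpi : Real.sqrt Real.pi ≠ 0 := (Real.sqrt_pos.2 Real.pi_pos).ne'
  have : besselK ν z = (2 * z) ^ ν / Real.sqrt Real.pi * (Real.Gamma (ν + 1 / 2) * C) := by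
    rw [besselK]; ring
  rw [this, hswap, hJ, hz2]
  field_simp

theorem lintegral_ofReal_eq_of_integral_pos {X : Type*} [MeasurableSpace X] {μ : Measure X}
    {f : X → ℝ} (hf : 0 ≤ᵐ[μ] f) (h : 0 < ∫ x, f x ∂μ) :
    ∫⁻ x, ENNReal.ofReal (f x) ∂μ = ENNReal.ofReal (∫ x, f x ∂μ) := by
  refine (ofReal_integral_eq_lintegral_ofReal ?_ hf).symm
  by_contra hcon
  exact h.ne' (integral_undef hcon)

/-- The profile `y ↦ √y K_{1/β}(2 y ^ (β / 2))`, extended evenly and continuously to the line. -/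
noncomputable def profile (β y : ℝ) : ℝ :=
  1 / 2 * ∫ w in Ioi (0 : ℝ), w ^ (1 / β - 1) * Real.exp (-w - |y| ^ β / w)

theorem sqrt_mul_besselK {β y : ℝ} (hβ : 0 < β) (hy : 0 < y) :
    Real.sqrt y * besselK (1 / β) (2 * Real.sqrt (y ^ β)) = profile β y := by
  have hyβ : 0 < y ^ β := Real.rpow_pos_of_pos hy _
  have hs : 0 < Real.sqrt (y ^ β) := Real.sqrt_pos.2 hyβ
  rw [besselK_eq_integral_exp (by positivity) (by positivity), profile, abs_of_pos hy, mul_pow,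
    Real.sq_sqrt hyβ.le, show (2 : ℝ) ^ 2 * y ^ β / 4 = y ^ β by ring]
  have h : Real.sqrt y * (2 / (2 * Real.sqrt (y ^ β))) ^ (1 / β) = 1 := by
    rw [show (2 : ℝ) / (2 * Real.sqrt (y ^ β)) = (Real.sqrt (y ^ β))⁻¹ by field_simp,
      Real.sqrt_eq_rpow, Real.sqrt_eq_rpow, ← Real.rpow_mul hy.le, ← Real.rpow_neg hy.le,
      ← Real.rpow_mul hy.le, ← Real.rpow_add hy,
      show 1 / 2 + -(β * (1 / 2)) * (1 / β) = 0 by field_simp; ring, Real.rpow_zero]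
  linear_combination (1 / 2 * ∫ w in Ioi (0 : ℝ), w ^ (1 / β - 1) * Real.exp (-w - y ^ β / w)) * h

theorem profile_integrand_nonneg (β y : ℝ) {w : ℝ} (hw : w ∈ Ioi (0 : ℝ)) :
    0 ≤ w ^ (1 / β - 1) * Real.exp (-w - |y| ^ β / w) :=
  mul_nonneg (Real.rpow_nonneg (le_of_lt hw) _) (Real.exp_pos _).le

theorem profile_integrand_le (β y : ℝ) {w : ℝ} (hw : w ∈ Ioi (0 : ℝ)) :
    w ^ (1 / β - 1) * Real.exp (-w - |y| ^ β / w) ≤ Real.exp (-w) * w ^ (1 / β - 1) := by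
  have hw0 : (0 : ℝ) < w := hw
  rw [mul_comm]
  refine mul_le_mul_of_nonneg_right (Real.exp_le_exp.2 ?_) (Real.rpow_nonneg hw0.le _)
  have : 0 ≤ |y| ^ β / w := div_nonneg (Real.rpow_nonneg (abs_nonneg _) _) hw0.le
  linarith

theorem integrableOn_profile {β : ℝ} (hβ : 0 < β) (y : ℝ) :
    IntegrableOn (fun w : ℝ => w ^ (1 / β - 1) * Real.exp (-w - |y| ^ β / w)) (Ioi 0) := by
  refine Integrable.mono' (Real.GammaIntegral_convergent (one_div_pos.2 hβ))
    (Measurable.aestronglyMeasurable (by fun_prop))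
    ((ae_restrict_iff' measurableSet_Ioi).2 (ae_of_all _ fun w hw => ?_))
  rw [Real.norm_of_nonneg (profile_integrand_nonneg β y hw)]
  exact profile_integrand_le β y hw

theorem profile_nonneg (β y : ℝ) : 0 ≤ profile β y :=
  mul_nonneg (by norm_num)
    (setIntegral_nonneg measurableSet_Ioi fun _ hw => profile_integrand_nonneg β y hw)

theorem profile_le {β : ℝ} (hβ : 0 < β) (y : ℝ) : profile β y ≤ 1 / 2 * Real.Gamma (1 / β) := by
  rw [Real.Gamma_eq_integral (one_div_pos.2 hβ)]
  exact mul_le_mul_of_nonneg_left (setIntegral_mono_on (integrableOn_profile hβ y)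
    (Real.GammaIntegral_convergent (one_div_pos.2 hβ)) measurableSet_Ioi
    fun w hw => profile_integrand_le β y hw) (by norm_num)

theorem profile_zero {β : ℝ} (hβ : 0 < β) : profile β 0 = 1 / 2 * Real.Gamma (1 / β) := by
  rw [Real.Gamma_eq_integral (one_div_pos.2 hβ), profile]
  simp [Real.zero_rpow hβ.ne', mul_comm]

theorem continuous_profile {β : ℝ} (hβ : 0 < β) : Continuous (profile β) := by
  refine continuous_const.mul (continuous_of_dominated
    (fun y => (integrableOn_profile hβ y).aestronglyMeasurable)
    (fun y => (ae_restrict_iff' measurableSet_Ioi).2 (ae_of_all _ fun w hw => ?_))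
    (Real.GammaIntegral_convergent (one_div_pos.2 hβ)) (ae_of_all _ fun w => ?_))
  · rw [Real.norm_of_nonneg (profile_integrand_nonneg β y hw)]
    exact profile_integrand_le β y hw
  · have : Continuous fun y : ℝ => |y| ^ β := continuous_abs.rpow_const fun _ => Or.inr hβ.le
    fun_prop

/-- The moments of the rescaled profile. -/
theorem lintegral_rpow_mul_profile {β s d : ℝ} (hβ : 0 < β) (hs : 0 < s) (hd : 0 < d) :
    ∫⁻ x in Ioi (0 : ℝ), ENNReal.ofReal (x ^ (s - 1) * profile β (d * x))
      = ENNReal.ofReal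
        (d ^ (-s) * (Real.Gamma (s / β) * Real.Gamma ((s + 1) / β) / (2 * β))) := by
  have hΓ : 0 < Real.Gamma (s / β) := Real.Gamma_pos_of_pos (by positivity)
  have hΓ' : 0 < Real.Gamma ((s + 1) / β) := Real.Gamma_pos_of_pos (by positivity)
  set f : ℝ → ℝ → ℝ := fun x w => 1 / 2 * (w ^ (1 / β - 1) * Real.exp (-w))
    * (x ^ (s - 1) * Real.exp (-(d ^ β / w) * x ^ β)) with hf
  have h1 : ∀ x ∈ Ioi (0 : ℝ), ENNReal.ofReal (x ^ (s - 1) * profile β (d * x))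
      = ∫⁻ w in Ioi (0 : ℝ), ENNReal.ofReal (f x w) := by
    intro x hx
    have hx0 : (0 : ℝ) < x := hx
    rw [profile, ← mul_assoc, ← integral_const_mul,
      ofReal_integral_eq_lintegral_ofReal ((integrableOn_profile hβ (d * x)).const_mul _)
        ((ae_restrict_iff' measurableSet_Ioi).2 (ae_of_all _ fun w hw =>
          mul_nonneg (by positivity) (profile_integrand_nonneg β (d * x) hw)))]
    refine lintegral_congr fun w => congrArg ENNReal.ofReal ?_
    rw [hf, abs_of_pos (mul_pos hd hx0), Real.mul_rpow hd.le hx0.le, sub_eq_add_neg (-w),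
      Real.exp_add, show -(d ^ β * x ^ β / w) = -(d ^ β / w) * x ^ β by ring]
    ring
  have h2 : ∀ w ∈ Ioi (0 : ℝ), ∫⁻ x in Ioi (0 : ℝ), ENNReal.ofReal (f x w)
      = ENNReal.ofReal (1 / (2 * β) * Real.Gamma (s / β) * d ^ (-s))
        * ENNReal.ofReal (Real.exp (-w) * w ^ ((s + 1) / β - 1)) := by
    intro w hw
    have hw0 : (0 : ℝ) < w := hw
    have hdw : 0 < d ^ β / w := div_pos (Real.rpow_pos_of_pos hd _) hw0
    have hval := integral_rpow_mul_exp_neg_mul_rpow hβ (by linarith : -1 < s - 1) hdw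
    have hpos : 0 < ∫ x in Ioi (0 : ℝ), x ^ (s - 1) * Real.exp (-(d ^ β / w) * x ^ β) := by
      rw [hval, sub_add_cancel]
      positivity
    have hcst : 0 ≤ 1 / 2 * (w ^ (1 / β - 1) * Real.exp (-w)) := by positivity
    simp only [hf, ENNReal.ofReal_mul hcst]
    rw [lintegral_const_mul' _ _ ENNReal.ofReal_ne_top, lintegral_ofReal_eq_of_integral_pos
      ((ae_restrict_iff' measurableSet_Ioi).2 (ae_of_all _ fun x hx =>
        mul_nonneg (Real.rpow_nonneg (le_of_lt hx) _) (Real.exp_pos _).le)) hpos, hval,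
      sub_add_cancel, ← ENNReal.ofReal_mul hcst, ← ENNReal.ofReal_mul (by positivity)]
    congr 1
    have e1 : (d ^ β / w) ^ (-s / β) = d ^ (-s) * w ^ (s / β) := by
      rw [Real.div_rpow (Real.rpow_nonneg hd.le _) hw0.le, ← Real.rpow_mul hd.le, neg_div,
        Real.rpow_neg hw0.le, show β * -(s / β) = -s by field_simp, div_inv_eq_mul]
    have e2 : w ^ ((s + 1) / β - 1) = w ^ (1 / β - 1) * w ^ (s / β) := by
      rw [← Real.rpow_add hw0]; ring_nf
    rw [e1, e2]
    field_simp
  have hexp : ∫⁻ w in Ioi (0 : ℝ), ENNReal.ofReal (Real.exp (-w) * w ^ ((s + 1) / β - 1))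
      = ENNReal.ofReal (Real.Gamma ((s + 1) / β)) := by
    rw [Real.Gamma_eq_integral (by positivity)] at hΓ' ⊢
    exact lintegral_ofReal_eq_of_integral_pos ((ae_restrict_iff' measurableSet_Ioi).2
      (ae_of_all _ fun x hx => mul_nonneg (Real.exp_pos _).le (Real.rpow_nonneg (le_of_lt hx) _)))
      hΓ'
  rw [setLIntegral_congr_fun measurableSet_Ioi h1, lintegral_lintegral_swap
      (Measurable.aemeasurable (by simp only [hf, Function.uncurry_def]; fun_prop)),
    setLIntegral_congr_fun measurableSet_Ioi h2, lintegral_const_mul' _ _ ENNReal.ofReal_ne_top,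
    hexp, ← ENNReal.ofReal_mul (by positivity)]
  congr 1
  ring

/-- The terms of the Bessel series in terms of the profile. -/
theorem seriesTerm_eq {σ lam θ α x : ℝ} (hσ : σ ≠ 0) (hlam : 0 < lam) (hθ : 1 < θ) (hα2 : α < 2)
    (hx : x ≠ 0) (n : ℕ) :
    seriesTerm σ lam θ α x n = coeff θ α n / θ ^ n
      * profile (2 - α) ((2 * lam / (σ ^ 2 * (2 - α) ^ 2)) ^ (1 / (2 - α)) * θ ^ n * |x|) := by
  have hβ : 0 < 2 - α := by linarith
  have hθ0 : 0 < θ := by linarith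
  have hx' : 0 < |x| := abs_pos.2 hx
  have hB : 0 < 2 * lam / (σ ^ 2 * (2 - α) ^ 2) := by positivity
  rw [← sqrt_mul_besselK hβ (by positivity), seriesTerm, mul_assoc]
  congr 5
  rw [Real.mul_rpow (by positivity) hx'.le, Real.mul_rpow (by positivity) (by positivity),
    ← Real.rpow_mul hB.le, one_div_mul_cancel hβ.ne', Real.rpow_one, Real.rpow_mul hθ0.le,
    Real.rpow_natCast]
  ring

theorem coeff_zero (θ α : ℝ) : coeff θ α 0 = 1 := by simp [coeff]

section
variable {θ α : ℝ}

theorem one_lt_rpow_two_sub (hθ : 1 < θ) (hα2 : α < 2) : 1 < θ ^ (2 - α) :=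
  Real.one_lt_rpow hθ (by linarith)

theorem rpow_natCast_mul_two_sub (hθ : 1 < θ) (n : ℕ) :
    θ ^ ((n : ℝ) * (2 - α)) = (θ ^ (2 - α)) ^ n := by
  rw [mul_comm, Real.rpow_mul (by linarith), Real.rpow_natCast]

theorem coeff_succ (hθ : 1 < θ) (n : ℕ) :
    coeff θ α (n + 1) = coeff θ α n * (θ ^ (2 - α) / (1 - (θ ^ (2 - α)) ^ (n + 1))) := by
  rw [coeff, Finset.prod_Icc_succ_top (by omega), rpow_natCast_mul_two_sub hθ, coeff]

theorem one_sub_pow_ne_zero (hθ : 1 < θ) (hα2 : α < 2) (n : ℕ) :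
    1 - (θ ^ (2 - α)) ^ (n + 1) ≠ 0 :=
  (sub_neg.2 (one_lt_pow₀ (one_lt_rpow_two_sub hθ hα2) n.succ_ne_zero)).ne

theorem coeff_ne_zero (hθ : 1 < θ) (hα2 : α < 2) (n : ℕ) : coeff θ α n ≠ 0 := by
  induction n with
  | zero => simp [coeff_zero]
  | succ n ih =>
    rw [coeff_succ hθ]
    exact mul_ne_zero ih (div_ne_zero (by linarith [one_lt_rpow_two_sub hθ hα2])
      (one_sub_pow_ne_zero hθ hα2 n))

theorem coeff_succ_mul (hθ : 1 < θ) (hα2 : α < 2) (n : ℕ) :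
    coeff θ α (n + 1) * (1 - (θ ^ (2 - α)) ^ (n + 1)) = θ ^ (2 - α) * coeff θ α n := by
  have := one_sub_pow_ne_zero hθ hα2 n
  rw [coeff_succ hθ]
  field_simp

theorem summable_abs_coeff_mul_pow (hθ : 1 < θ) (hα2 : α < 2) {r : ℝ} (hr : 0 < r) :
    Summable fun n => |coeff θ α n| * r ^ n := by
  have hq := one_lt_rpow_two_sub hθ hα2
  refine summable_of_ratio_test_tendsto_lt_one zero_lt_one (Eventually.of_forall fun n =>
    mul_ne_zero (abs_ne_zero.2 (coeff_ne_zero hθ hα2 n)) (pow_pos hr n).ne') ?_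
  have ht : Tendsto (fun n : ℕ => (θ ^ (2 - α) * r) / ((θ ^ (2 - α)) ^ (n + 1) - 1)) atTop
      (𝓝 0) := by
    refine Tendsto.div_atTop tendsto_const_nhds ?_
    exact tendsto_atTop_add_const_right _ (-1)
      ((tendsto_add_atTop_iff_nat 1).2 (tendsto_pow_atTop_atTop_of_one_lt hq))
  refine ht.congr fun n => ?_
  have h1 : 0 < (θ ^ (2 - α)) ^ (n + 1) - 1 := sub_pos.2 (one_lt_pow₀ hq n.succ_ne_zero)
  have h2 : 0 < |coeff θ α n| := abs_pos.2 (coeff_ne_zero hθ hα2 n)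
  rw [coeff_succ hθ, abs_mul, abs_div, abs_sub_comm, abs_of_pos h1,
    abs_of_pos (by linarith : 0 < θ ^ (2 - α)), Real.norm_of_nonneg (by positivity),
    Real.norm_of_nonneg (by positivity), pow_succ r]
  field_simp

/-- The generating function of the coefficients. -/
noncomputable def genFun (θ α z : ℝ) : ℝ := ∑' n, coeff θ α n * z ^ n

theorem summable_coeff_mul_pow (hθ : 1 < θ) (hα2 : α < 2) {z : ℝ} (hz : 0 < z) :
    Summable fun n => coeff θ α n * z ^ n :=
  Summable.of_norm (by simpa [abs_of_pos hz] using summable_abs_coeff_mul_pow hθ hα2 hz)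

theorem genFun_mul (hθ : 1 < θ) (hα2 : α < 2) {z : ℝ} (hz : 0 < z) :
    genFun θ α (θ ^ (2 - α) * z) = (1 - θ ^ (2 - α) * z) * genFun θ α z := by
  have hq := one_lt_rpow_two_sub hθ hα2
  have hs := summable_coeff_mul_pow hθ hα2 hz
  have hs' := summable_coeff_mul_pow hθ hα2 (z := θ ^ (2 - α) * z) (by positivity)
  have hd : genFun θ α z - genFun θ α (θ ^ (2 - α) * z) = θ ^ (2 - α) * z * genFun θ α z := by
    rw [genFun, genFun, ← hs.tsum_sub hs', (hs.sub hs').tsum_eq_zero_add, ← tsum_mul_left]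
    simp only [pow_zero, sub_self, zero_add]
    refine tsum_congr fun n => ?_
    have := coeff_succ_mul hθ hα2 n
    rw [mul_pow]
    linear_combination z ^ (n + 1) * this
  linarith

theorem genFun_eq_prod_mul (hθ : 1 < θ) (hα2 : α < 2) {z : ℝ} (hz : 0 < z) (N : ℕ) :
    genFun θ α z = (∏ k ∈ Finset.range N, (1 - z / (θ ^ (2 - α)) ^ k))
      * genFun θ α (z / (θ ^ (2 - α)) ^ N) := by
  have hq := one_lt_rpow_two_sub hθ hα2
  induction N with
  | zero => simp
  | succ N ih =>
    have := genFun_mul hθ hα2 (z := z / (θ ^ (2 - α)) ^ (N + 1)) (by positivity)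
    rw [show θ ^ (2 - α) * (z / (θ ^ (2 - α)) ^ (N + 1)) = z / (θ ^ (2 - α)) ^ N by
      rw [pow_succ']; field_simp] at this
    rw [ih, Finset.prod_range_succ, this]
    ring

theorem tendsto_genFun_div_pow (hθ : 1 < θ) (hα2 : α < 2) {z : ℝ} (hz : 0 < z) :
    Tendsto (fun N : ℕ => genFun θ α (z / (θ ^ (2 - α)) ^ N)) atTop (𝓝 1) := by
  have hq := one_lt_rpow_two_sub hθ hα2
  have h1 : ∑' n, coeff θ α n * (0 : ℝ) ^ n = 1 := by
    rw [tsum_eq_single 0 fun n hn => by simp [hn]]; simp [coeff_zero]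
  rw [← h1]
  refine tendsto_tsum_of_dominated_convergence (summable_abs_coeff_mul_pow hθ hα2 hz)
    (fun n => ?_) (Eventually.of_forall fun N n => ?_)
  · refine Tendsto.const_mul _ (Tendsto.pow ?_ n)
    exact tendsto_const_nhds.div_atTop (tendsto_pow_atTop_atTop_of_one_lt hq)
  · have h0 : 0 < z / (θ ^ (2 - α)) ^ N := by positivity
    rw [norm_mul, norm_pow, Real.norm_of_nonneg h0.le, Real.norm_eq_abs]
    gcongr
    exact div_le_self hz.le (one_le_pow₀ hq.le)

theorem genFun_pos (hθ : 1 < θ) (hα2 : α < 2) {z : ℝ} (hz : 0 < z) (hz1 : z < 1) :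
    0 < genFun θ α z := by
  have hq := one_lt_rpow_two_sub hθ hα2
  obtain ⟨N, hN⟩ := ((tendsto_genFun_div_pow hθ hα2 hz).eventually (lt_mem_nhds zero_lt_one)).exists
  rw [genFun_eq_prod_mul hθ hα2 hz N]
  refine mul_pos (Finset.prod_pos fun k _ => sub_pos.2 ?_) hN
  exact lt_of_le_of_lt (div_le_self hz.le (one_le_pow₀ hq.le)) hz1

theorem tprod_eq_genFun (hθ : 1 < θ) (hα2 : α < 2) :
    ∏' k : ℕ, (1 - 1 / θ ^ (2 + (k : ℝ) * (2 - α))) = genFun θ α (θ ^ (-2 : ℝ)) := by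
  have hθ0 : 0 < θ := by linarith
  have hz : 0 < θ ^ (-2 : ℝ) := Real.rpow_pos_of_pos hθ0 _
  have h1 := (multipliable_normConst hθ hα2).hasProd.tendsto_prod_nat.mul
    (tendsto_genFun_div_pow hθ hα2 hz)
  rw [mul_one] at h1
  refine tendsto_nhds_unique h1 (tendsto_const_nhds.congr fun N => ?_)
  rw [genFun_eq_prod_mul hθ hα2 hz N]
  congr 1
  refine Finset.prod_congr rfl fun k _ => ?_
  rw [Real.rpow_add hθ0, rpow_natCast_mul_two_sub hθ, Real.rpow_neg hθ0.le]
  field_simp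

end

theorem not_integrableOn_Ioi_of_le {f : ℝ → ℝ} {a N ε : ℝ} (hε : 0 < ε)
    (hf : ∀ x, N < x → ε ≤ f x) : ¬ IntegrableOn f (Ioi a) := by
  intro hi
  have h1 : IntegrableOn (fun _ : ℝ => ε) (Ioi (max a N)) := by
    refine Integrable.mono' (hi.mono_set (Ioi_subset_Ioi (le_max_left a N)))
      aestronglyMeasurable_const
      ((ae_restrict_iff' measurableSet_Ioi).2 (ae_of_all _ fun x hx => ?_))
    rw [Real.norm_of_nonneg hε.le]
    exact hf x (lt_of_le_of_lt (le_max_right a N) hx)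
  rw [integrableOn_const_iff] at h1
  simp [hε.ne'] at h1

/-- A function whose derivative has a positive limit at infinity tends to infinity. -/
theorem tendsto_atTop_of_tendsto_deriv {f : ℝ → ℝ} {C : ℝ} (hC : 0 < C)
    (hf : ∀ x, 0 < x → DifferentiableAt ℝ f x) (h : Tendsto (deriv f) atTop (𝓝 C)) :
    Tendsto f atTop atTop := by
  obtain ⟨N, hN⟩ := eventually_atTop.1
    ((h.eventually (lt_mem_nhds (half_lt_self hC))).and (eventually_gt_atTop 0))
  have hN0 : 0 < N := (hN N le_rfl).2
  have hmv : ∀ x, N ≤ x → C / 2 * (x - N) ≤ f x - f N := fun x hx =>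
    (convex_Ici N).mul_sub_le_image_sub_of_le_deriv
      (fun y hy => (hf y (hN0.trans_le hy)).continuousAt.continuousWithinAt)
      (fun y hy => (hf y (hN0.trans_le (interior_subset hy))).differentiableWithinAt)
      (fun y hy => (hN y (interior_subset hy)).1.le) N self_mem_Ici x hx hx
  refine tendsto_atTop_mono' _ (f₁ := fun x => C / 2 * (x - N) + f N) ?_ ?_
  · filter_upwards [eventually_ge_atTop N] with x hx
    linarith [hmv x hx]
  · exact tendsto_atTop_add_const_right _ _ (Tendsto.const_mul_atTop (half_pos hC)
      (tendsto_atTop_add_const_right _ _ tendsto_id))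

theorem lintegral_mul_lintegral_mul_comm {X Y : Type*} [MeasurableSpace X] [MeasurableSpace Y]
    {μ : Measure X} {ν : Measure Y} [SFinite μ] [SFinite ν] {f : X → ENNReal} {J : Y → ENNReal}
    {k : X → Y → ENNReal} (hf : Measurable f) (hJ : Measurable J)
    (hk : Measurable (Function.uncurry k)) :
    ∫⁻ x, f x * ∫⁻ y, k x y * J y ∂ν ∂μ = ∫⁻ y, (∫⁻ x, f x * k x y ∂μ) * J y ∂ν := by
  have hk1 : ∀ x, Measurable (k x) := fun x => hk.of_uncurry_left
  have hk2 : ∀ y, Measurable fun x => k x y := fun y => hk.of_uncurry_right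
  have e1 : ∀ x, f x * ∫⁻ y, k x y * J y ∂ν = ∫⁻ y, f x * k x y * J y ∂ν := fun x => by
    simp_rw [mul_assoc]
    exact (lintegral_const_mul _ ((hk1 x).mul hJ)).symm
  have e2 : ∀ y, (∫⁻ x, f x * k x y ∂μ) * J y = ∫⁻ x, f x * k x y * J y ∂μ := fun y =>
    (lintegral_mul_const _ (hf.mul (hk2 y))).symm
  simp_rw [e1, e2]
  exact lintegral_lintegral_swap
    (((hf.comp measurable_fst).mul hk).mul (hJ.comp measurable_snd)).aemeasurable

/-- The hypotheses of the stationary problem on the positive half-line. -/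
structure IsHalfLineSolution (c α θ : ℝ) (p : ℝ → ℝ) : Prop where
  nonneg : ∀ x, 0 ≤ p x
  integrable : Integrable p
  continuous : Continuous p
  contDiffOn : ContDiffOn ℝ 2 p (Ioi 0)
  deriv_deriv : ∀ x, 0 < x → deriv (deriv p) x
    = c * x ^ (-α) * p x - θ * (c * (θ * x) ^ (-α) * p (θ * x))

namespace IsHalfLineSolution

variable {c α θ : ℝ} {p : ℝ → ℝ}

theorem hasDerivAt (h : IsHalfLineSolution c α θ p) {x : ℝ} (hx : 0 < x) :
    HasDerivAt p (deriv p x) x :=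
  ((h.contDiffOn.differentiableOn (by norm_num)).differentiableAt (Ioi_mem_nhds hx)).hasDerivAt

theorem hasDerivAt_deriv (h : IsHalfLineSolution c α θ p) {x : ℝ} (hx : 0 < x) :
    HasDerivAt (deriv p) (deriv (deriv p) x) x :=
  (((h.contDiffOn.deriv_of_isOpen (m := 1) isOpen_Ioi (by norm_num)).differentiableOn
    (by norm_num)).differentiableAt (Ioi_mem_nhds hx)).hasDerivAt

theorem continuousAt_source (h : IsHalfLineSolution c α θ p) {x : ℝ} (hx : 0 < x) :
    ContinuousAt (fun z => c * z ^ (-α) * p z) x :=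
  (continuousAt_const.mul (continuousAt_id.rpow_const (Or.inl hx.ne'))).mul h.continuous.continuousAt

theorem measurable_source (h : IsHalfLineSolution c α θ p) :
    Measurable fun z => c * z ^ (-α) * p z := by
  have := h.continuous.measurable
  fun_prop

theorem source_nonneg (h : IsHalfLineSolution c α θ p) (hc : 0 < c) {x : ℝ} (hx : 0 < x) :
    0 ≤ c * x ^ (-α) * p x :=
  mul_nonneg (by positivity) (h.nonneg x)

theorem intervalIntegrable_source (h : IsHalfLineSolution c α θ p) {a b : ℝ} (ha : 0 < a)
    (hb : 0 < b) : IntervalIntegrable (fun z => c * z ^ (-α) * p z) volume a b :=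
  ContinuousOn.intervalIntegrable fun _ hx =>
    (h.continuousAt_source (lt_of_lt_of_le (lt_min ha hb) hx.1)).continuousWithinAt

/-- The stationary equation integrated once. -/
theorem deriv_eq (h : IsHalfLineSolution c α θ p) (hc : 0 < c) (hθ : 1 < θ) (hα0 : 0 ≤ α)
    {x : ℝ} (hx : 0 < x) : deriv p x = -∫ z in x..θ * x, c * z ^ (-α) * p z := by
  have hθ0 : 0 < θ := by linarith
  set Q : ℝ → ℝ := fun z => c * z ^ (-α) * p z with hQ
  set Φ : ℝ → ℝ := fun x => ∫ z in (1 : ℝ)..x, Q z with hΦ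
  have hΦd : ∀ x, 0 < x → HasDerivAt Φ (Q x) x := fun x hx =>
    intervalIntegral.integral_hasDerivAt_right (h.intervalIntegrable_source one_pos hx)
      h.measurable_source.stronglyMeasurable.stronglyMeasurableAtFilter (h.continuousAt_source hx)
  have hΦsub : ∀ x, 0 < x → ∫ z in x..θ * x, Q z = Φ (θ * x) - Φ x := fun x hx =>
    (intervalIntegral.integral_interval_sub_left
      (h.intervalIntegrable_source one_pos (by positivity))
      (h.intervalIntegrable_source one_pos hx)).symm
  have hD : ∀ x, 0 < x → HasDerivAt (fun x => deriv p x + (Φ (θ * x) - Φ x)) 0 x := by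
    intro x hx
    have h1 : HasDerivAt (fun x => Φ (θ * x)) (Q (θ * x) * θ) x := by
      refine (hΦd (θ * x) (by positivity)).comp x ?_
      simpa using (hasDerivAt_id x).const_mul θ
    refine ((h.hasDerivAt_deriv hx).add (h1.sub (hΦd x hx))).congr_deriv ?_
    rw [h.deriv_deriv x hx]
    ring
  have hconst : ∀ x, 0 < x → deriv p x + (Φ (θ * x) - Φ x) = deriv p 1 + (Φ (θ * 1) - Φ 1) :=
    fun x hx => isOpen_Ioi.is_const_of_deriv_eq_zero isPreconnected_Ioi
      (fun y hy => (hD y hy).differentiableAt.differentiableWithinAt)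
      (fun y hy => (hD y hy).deriv) hx (one_pos : (0 : ℝ) < 1)
  set C := deriv p 1 + (Φ (θ * 1) - Φ 1)
  have hQi : IntegrableOn Q (Ioi 1) := by
    refine Integrable.mono' (h.integrable.integrableOn.const_mul c)
      h.measurable_source.aestronglyMeasurable
      ((ae_restrict_iff' measurableSet_Ioi).2 (ae_of_all _ fun x hx => ?_))
    have hx1 : (1 : ℝ) < x := hx
    rw [Real.norm_of_nonneg (h.source_nonneg hc (by linarith))]
    refine mul_le_mul_of_nonneg_right (mul_le_of_le_one_right hc.le ?_) (h.nonneg x)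
    exact Real.rpow_le_one_of_one_le_of_nonpos hx1.le (by linarith)
  have hlim := intervalIntegral_tendsto_integral_Ioi 1 hQi tendsto_id
  have hlim' := intervalIntegral_tendsto_integral_Ioi 1 hQi
    (Tendsto.const_mul_atTop hθ0 tendsto_id)
  have hdC : Tendsto (deriv p) atTop (𝓝 C) := by
    have : Tendsto (fun x => C - (Φ (θ * x) - Φ x)) atTop (𝓝 C) := by
      simpa using (tendsto_const_nhds (x := C)).sub (hlim'.sub hlim)
    refine this.congr' ?_
    filter_upwards [eventually_gt_atTop 0] with x hx
    rw [← hconst x hx]; ring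
  have hC : C = 0 := by
    rcases lt_trichotomy C 0 with hC | hC | hC
    · have h1 : deriv (fun x => -p x) = fun x => -deriv p x := funext fun _ => deriv.fun_neg
      have := tendsto_atTop_of_tendsto_deriv (f := fun x => -p x) (neg_pos.2 hC)
        (fun x hx => (h.hasDerivAt hx).differentiableAt.neg) (by rw [h1]; exact hdC.neg)
      obtain ⟨x, hx⟩ := (this.eventually (eventually_gt_atTop 0)).exists
      linarith [h.nonneg x]
    · exact hC
    · have := tendsto_atTop_of_tendsto_deriv hC (fun x hx => (h.hasDerivAt hx).differentiableAt) hdC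
      obtain ⟨N, hN⟩ := eventually_atTop.1 (this.eventually (eventually_ge_atTop 1))
      exact (not_integrableOn_Ioi_of_le one_pos (fun x hx => hN x (le_of_lt hx))
        (h.integrable.integrableOn (s := Ioi 0))).elim
  rw [hΦsub x hx]
  linarith [hconst x hx]

theorem deriv_nonpos (h : IsHalfLineSolution c α θ p) (hc : 0 < c) (hθ : 1 < θ) (hα0 : 0 ≤ α)
    {x : ℝ} (hx : 0 < x) : deriv p x ≤ 0 := by
  rw [h.deriv_eq hc hθ hα0 hx, neg_nonpos]
  exact intervalIntegral.integral_nonneg (by nlinarith)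
    fun z hz => h.source_nonneg hc (hx.trans_le hz.1)

theorem tendsto_zero (h : IsHalfLineSolution c α θ p) (hc : 0 < c) (hθ : 1 < θ) (hα0 : 0 ≤ α) :
    Tendsto p atTop (𝓝 0) := by
  have hanti : AntitoneOn p (Ioi 0) := by
    refine antitoneOn_of_deriv_nonpos (convex_Ioi 0) h.continuous.continuousOn
      (fun x hx => ?_) fun x hx => ?_
    · exact (h.hasDerivAt (interior_subset hx)).differentiableAt.differentiableWithinAt
    · exact h.deriv_nonpos hc hθ hα0 (interior_subset hx)
  rw [Metric.tendsto_atTop]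
  intro ε hε
  by_contra! hcon
  refine not_integrableOn_Ioi_of_le (N := 0) hε (fun x hx => ?_)
    (h.integrable.integrableOn (s := Ioi 0))
  obtain ⟨y, hxy, hy⟩ := hcon x
  rw [Real.dist_eq, sub_zero, abs_of_nonneg (h.nonneg y)] at hy
  exact hy.trans (hanti hx (lt_of_lt_of_le hx hxy) hxy)

theorem ofReal_eq_lintegral (h : IsHalfLineSolution c α θ p) (hc : 0 < c) (hθ : 1 < θ)
    (hα0 : 0 ≤ α) {x : ℝ} (hx : 0 < x) :
    ENNReal.ofReal (p x)
      = ∫⁻ y in Ioi x, ∫⁻ z in Ioc y (θ * y), ENNReal.ofReal (c * z ^ (-α) * p z) := by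
  have hd : ∀ y ∈ Ici x, HasDerivAt p (deriv p y) y := fun y hy => h.hasDerivAt (hx.trans_le hy)
  have hn : ∀ y ∈ Ioi x, deriv p y ≤ 0 := fun y hy => h.deriv_nonpos hc hθ hα0 (hx.trans hy)
  have ht := h.tendsto_zero hc hθ hα0
  have h1 := integral_Ioi_of_hasDerivAt_of_nonpos' hd hn ht
  have h2 := integrableOn_Ioi_deriv_of_nonpos' hd hn ht
  have h3 : p x = ∫ y in Ioi x, -deriv p y := by rw [integral_neg, h1]; ring
  rw [h3, ofReal_integral_eq_lintegral_ofReal (f := fun y => -deriv p y) h2.neg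
    ((ae_restrict_iff' measurableSet_Ioi).2 (ae_of_all _ fun y hy => neg_nonneg.2 (hn y hy)))]
  refine setLIntegral_congr_fun measurableSet_Ioi fun y hy => ?_
  have hy0 : 0 < y := hx.trans hy
  have hle : y ≤ θ * y := by nlinarith
  rw [h.deriv_eq hc hθ hα0 hy0, neg_neg, intervalIntegral.integral_of_le hle,
    ofReal_integral_eq_lintegral_ofReal]
  · exact (intervalIntegrable_iff_integrableOn_Ioc_of_le hle).1
      (h.intervalIntegrable_source hy0 (by nlinarith))
  · exact (ae_restrict_iff' measurableSet_Ioc).2 (ae_of_all _ fun z hz =>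
      h.source_nonneg hc (hy0.trans hz.1))

/-- The recursion satisfied by the moments of a solution. -/
theorem moment_eq (h : IsHalfLineSolution c α θ p) (hc : 0 < c) (hθ : 1 < θ) (hα0 : 0 ≤ α)
    {u : ℝ} (hu : 0 < u) :
    ∫⁻ x in Ioi (0 : ℝ), ENNReal.ofReal (x ^ (u - 1)) * ENNReal.ofReal (p x)
      = ENNReal.ofReal (c * (1 - θ ^ (-1 - u)) / (u * (u + 1)))
        * ∫⁻ x in Ioi (0 : ℝ), ENNReal.ofReal (x ^ (u + (2 - α) - 1)) * ENNReal.ofReal (p x) := by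
  have hθ0 : 0 < θ := by linarith
  set q : ℝ → ENNReal := fun z => ENNReal.ofReal (c * z ^ (-α) * p z) with hq
  have hqm : Measurable q := h.measurable_source.ennreal_ofReal
  set k₁ : ℝ → ℝ → ENNReal := fun x y => (Ioi x).indicator 1 y with hk₁
  set k₂ : ℝ → ℝ → ENNReal := fun y z => (Ioc y (θ * y)).indicator 1 z with hk₂
  have hk₁m : Measurable (Function.uncurry k₁) := by
    have : Function.uncurry k₁ = ({w : ℝ × ℝ | w.1 < w.2}).indicator 1 := by
      ext w; simp [hk₁, Function.uncurry, indicator_apply]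
    rw [this]
    exact measurable_one.indicator (measurableSet_lt measurable_fst measurable_snd)
  have hk₂m : Measurable (Function.uncurry k₂) := by
    have : Function.uncurry k₂
        = ({w : ℝ × ℝ | w.1 < w.2} ∩ {w : ℝ × ℝ | w.2 ≤ θ * w.1}).indicator 1 := by
      ext w; simp [hk₂, Function.uncurry, indicator_apply]
    rw [this]
    exact measurable_one.indicator ((measurableSet_lt measurable_fst measurable_snd).inter
      (measurableSet_le measurable_snd (measurable_fst.const_mul θ)))
  set J : ℝ → ENNReal := fun y => ∫⁻ z in Ioi (0 : ℝ), k₂ y z * q z with hJ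
  have hJm : Measurable J :=
    Measurable.lintegral_prod_right' (f := fun w : ℝ × ℝ => k₂ w.1 w.2 * q w.2)
      (hk₂m.mul (hqm.comp measurable_snd))
  have hp : ∀ x ∈ Ioi (0 : ℝ), ENNReal.ofReal (x ^ (u - 1)) * ENNReal.ofReal (p x)
      = ENNReal.ofReal (x ^ (u - 1)) * ∫⁻ y in Ioi (0 : ℝ), k₁ x y * J y := by
    intro x hx
    rw [h.ofReal_eq_lintegral hc hθ hα0 hx]
    congr 1
    have e1 : ∀ y, k₁ x y * J y = (Ioi x).indicator J y := by
      intro y; by_cases hy : y ∈ Ioi x <;> simp [hk₁, hy]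
    simp_rw [e1]
    rw [lintegral_indicator measurableSet_Ioi, Measure.restrict_restrict measurableSet_Ioi,
      inter_eq_left.2 (Ioi_subset_Ioi (le_of_lt hx))]
    refine setLIntegral_congr_fun measurableSet_Ioi fun y hy => ?_
    have hy0 : 0 < y := lt_trans hx hy
    have e2 : ∀ z, k₂ y z * q z = (Ioc y (θ * y)).indicator q z := by
      intro z; by_cases hz : z ∈ Ioc y (θ * y) <;> simp [hk₂, hz]
    simp only [hJ]
    simp_rw [e2]
    rw [lintegral_indicator measurableSet_Ioc, Measure.restrict_restrict measurableSet_Ioc,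
      inter_eq_left.2 (show Ioc y (θ * y) ⊆ Ioi 0 from fun z hz => hy0.trans hz.1)]
  have hpow : ∀ (a b s : ℝ), 0 ≤ a → a ≤ b → 0 < s →
      ∫⁻ x in Ioc a b, ENNReal.ofReal (x ^ (s - 1)) = ENNReal.ofReal ((b ^ s - a ^ s) / s) := by
    intro a b s ha hab hs
    have hi : IntervalIntegrable (fun x : ℝ => x ^ (s - 1)) volume a b :=
      intervalIntegral.intervalIntegrable_rpow' (by linarith)
    rw [← ofReal_integral_eq_lintegral_ofReal
      ((intervalIntegrable_iff_integrableOn_Ioc_of_le hab).1 hi)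
      ((ae_restrict_iff' measurableSet_Ioc).2 (ae_of_all _ fun x hx =>
        Real.rpow_nonneg (ha.trans (le_of_lt hx.1)) _)), ← intervalIntegral.integral_of_le hab,
      integral_rpow (Or.inl (by linarith)), sub_add_cancel]
  have hin : ∀ y ∈ Ioi (0 : ℝ), (∫⁻ x in Ioi (0 : ℝ), ENNReal.ofReal (x ^ (u - 1)) * k₁ x y) * J y
      = ENNReal.ofReal (u⁻¹ * y ^ (u + 1 - 1)) * J y := by
    intro y hy
    have hy0 : 0 < y := hy
    have e1 : ∀ x, ENNReal.ofReal (x ^ (u - 1)) * k₁ x y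
        = (Iio y).indicator (fun x => ENNReal.ofReal (x ^ (u - 1))) x := by
      intro x; by_cases hx : x < y <;> simp [hk₁, hx]
    simp_rw [e1]
    rw [lintegral_indicator measurableSet_Iio, Measure.restrict_restrict measurableSet_Iio,
      inter_comm, Ioi_inter_Iio, setLIntegral_congr Ioo_ae_eq_Ioc, hpow 0 y u le_rfl hy0.le hu,
      Real.zero_rpow hu.ne', sub_zero, add_sub_cancel_right, div_eq_inv_mul]
  have hout : ∀ z ∈ Ioi (0 : ℝ),
      (∫⁻ y in Ioi (0 : ℝ), ENNReal.ofReal (u⁻¹ * y ^ (u + 1 - 1)) * k₂ y z) * q z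
      = ENNReal.ofReal (c * (1 - θ ^ (-1 - u)) / (u * (u + 1)))
        * (ENNReal.ofReal (z ^ (u + (2 - α) - 1)) * ENNReal.ofReal (p z)) := by
    intro z hz
    have hz0 : 0 < z := hz
    have hzθ : 0 < z / θ := by positivity
    have e1 : ∀ y, ENNReal.ofReal (u⁻¹ * y ^ (u + 1 - 1)) * k₂ y z
        = (Ico (z / θ) z).indicator
          (fun y => ENNReal.ofReal u⁻¹ * ENNReal.ofReal (y ^ (u + 1 - 1))) y := by
      intro y
      have : z ∈ Ioc y (θ * y) ↔ y ∈ Ico (z / θ) z := by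
        rw [mem_Ioc, mem_Ico, div_le_iff₀ hθ0, mul_comm y θ, and_comm]
      rw [ENNReal.ofReal_mul (by positivity)]
      by_cases hy : y ∈ Ico (z / θ) z
      · simp [hk₂, this.2 hy, hy]
      · simp [hk₂, mt this.1 hy, hy]
    have hθ1 : θ ^ (-1 - u) ≤ 1 := Real.rpow_le_one_of_one_le_of_nonpos hθ.le (by linarith)
    simp_rw [e1]
    rw [lintegral_indicator measurableSet_Ico, Measure.restrict_restrict measurableSet_Ico,
      inter_eq_left.2 (show Ico (z / θ) z ⊆ Ioi 0 from fun y hy => hzθ.trans_le hy.1),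
      setLIntegral_congr Ico_ae_eq_Ioc,
      lintegral_const_mul' _ _ ENNReal.ofReal_ne_top,
      hpow (z / θ) z (u + 1) hzθ.le (div_le_self hz0.le hθ.le) (by linarith), hq,
      ← ENNReal.ofReal_mul (by positivity), ← ENNReal.ofReal_mul' (h.source_nonneg hc hz0),
      ← ENNReal.ofReal_mul (by positivity), ← ENNReal.ofReal_mul]
    · congr 1
      have e2 : (z / θ) ^ (u + 1) = z ^ (u + 1) * θ ^ (-1 - u) := by
        rw [Real.div_rpow hz0.le hθ0.le, show -1 - u = -(u + 1) by ring, Real.rpow_neg hθ0.le,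
          div_eq_mul_inv]
      have e3 : z ^ (u + (2 - α) - 1) = z ^ (u + 1) * z ^ (-α) := by
        rw [← Real.rpow_add hz0]; ring_nf
      rw [e2, e3]
      field_simp
    · exact div_nonneg (mul_nonneg hc.le (by linarith)) (by positivity)
  rw [setLIntegral_congr_fun measurableSet_Ioi hp,
    lintegral_mul_lintegral_mul_comm (by fun_prop) hJm hk₁m,
    setLIntegral_congr_fun measurableSet_Ioi hin, hJ,
    lintegral_mul_lintegral_mul_comm (by fun_prop) hqm hk₂m,
    setLIntegral_congr_fun measurableSet_Ioi hout,
    lintegral_const_mul' _ _ ENNReal.ofReal_ne_top]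

end IsHalfLineSolution

/-- The superposition of rescaled profiles with weights `w n / θ ^ n`. -/
noncomputable def profileSeries (β b θ : ℝ) (w : ℕ → ℝ) (x : ℝ) : ℝ :=
  ∑' n, w n / θ ^ n * profile β (b * θ ^ n * x)

/-- The moment of order `s - 1` of the profile rescaled by `b`. -/
noncomputable def profileMoment (β b s : ℝ) : ℝ :=
  b ^ (-s) * (Real.Gamma (s / β) * Real.Gamma ((s + 1) / β) / (2 * β))

section
variable {β b θ : ℝ} {w : ℕ → ℝ}

theorem norm_profileSeries_term_le (hβ : 0 < β) (hθ : 1 < θ) (x : ℝ) (n : ℕ) :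
    ‖w n / θ ^ n * profile β (b * θ ^ n * x)‖ ≤ |w n| * 1 ^ n * (1 / 2 * Real.Gamma (1 / β)) := by
  have h1 : 1 ≤ θ ^ n := one_le_pow₀ hθ.le
  rw [norm_mul, norm_div, Real.norm_of_nonneg (profile_nonneg _ _), Real.norm_eq_abs,
    Real.norm_of_nonneg (by positivity), one_pow, mul_one]
  exact mul_le_mul (div_le_self (abs_nonneg _) h1) (profile_le hβ _) (profile_nonneg _ _)
    (abs_nonneg _)

theorem summable_profileSeries (hβ : 0 < β) (hθ : 1 < θ)
    (hw : ∀ r : ℝ, 0 < r → Summable fun n => |w n| * r ^ n) (x : ℝ) :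
    Summable fun n => w n / θ ^ n * profile β (b * θ ^ n * x) :=
  Summable.of_norm_bounded ((hw 1 one_pos).mul_right _) (norm_profileSeries_term_le hβ hθ x)

theorem continuous_profileSeries (hβ : 0 < β) (hθ : 1 < θ)
    (hw : ∀ r : ℝ, 0 < r → Summable fun n => |w n| * r ^ n) :
    Continuous (profileSeries β b θ w) :=
  continuous_tsum
    (fun _ => continuous_const.mul ((continuous_profile hβ).comp (continuous_const.mul continuous_id)))
    ((hw 1 one_pos).mul_right _) fun n x => norm_profileSeries_term_le hβ hθ x n

theorem profileSeries_nonneg (hθ : 1 < θ) (hw0 : ∀ n, 0 ≤ w n) (x : ℝ) :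
    0 ≤ profileSeries β b θ w x :=
  tsum_nonneg fun n =>
    mul_nonneg (div_nonneg (hw0 n) (pow_nonneg (by linarith) n)) (profile_nonneg _ _)

theorem profileMoment_pos (hβ : 0 < β) (hb : 0 < b) {s : ℝ} (hs : 0 < s) :
    0 < profileMoment β b s := by
  have h1 : 0 < Real.Gamma (s / β) := Real.Gamma_pos_of_pos (by positivity)
  have h2 : 0 < Real.Gamma ((s + 1) / β) := Real.Gamma_pos_of_pos (by positivity)
  unfold profileMoment
  positivity

theorem profileMoment_add (hβ : 0 < β) (hb : 0 < b) {s c : ℝ} (hs : 0 < s)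
    (hbc : b ^ β * β ^ 2 = c) :
    c * profileMoment β b (s + β) = s * (s + 1) * profileMoment β b s := by
  have h1 : (s + β) / β = s / β + 1 := by field_simp
  have h2 : (s + β + 1) / β = (s + 1) / β + 1 := by field_simp; ring
  have h3 : b ^ (-(s + β)) = b ^ (-s) * (b ^ β)⁻¹ := by
    rw [neg_add, Real.rpow_add hb, Real.rpow_neg hb.le β]
  have h4 : b ^ β ≠ 0 := (Real.rpow_pos_of_pos hb _).ne'
  rw [profileMoment, profileMoment, h1, h2, Real.Gamma_add_one (by positivity),
    Real.Gamma_add_one (by positivity), h3, ← hbc]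
  field_simp

theorem lintegral_rpow_mul_profileSeries (hβ : 0 < β) (hb : 0 < b) (hθ : 1 < θ)
    (hw0 : ∀ n, 0 ≤ w n) (hw : ∀ r : ℝ, 0 < r → Summable fun n => |w n| * r ^ n)
    {s : ℝ} (hs : 0 < s) :
    ∫⁻ x in Ioi (0 : ℝ), ENNReal.ofReal (x ^ (s - 1)) * ENNReal.ofReal (profileSeries β b θ w x)
      = ENNReal.ofReal (profileMoment β b s * ∑' n, w n * (θ ^ (-1 - s)) ^ n) := by
  have hθ0 : 0 < θ := by linarith
  have hr : 0 < θ ^ (-1 - s) := Real.rpow_pos_of_pos hθ0 _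
  have hM := profileMoment_pos hβ hb hs
  have h0 : ∀ n, 0 ≤ w n / θ ^ n := fun n => div_nonneg (hw0 n) (by positivity)
  have hsum : Summable fun n => w n * (θ ^ (-1 - s)) ^ n := by
    simpa [abs_of_nonneg (hw0 _)] using hw _ hr
  have e1 : ∀ x ∈ Ioi (0 : ℝ),
      ENNReal.ofReal (x ^ (s - 1)) * ENNReal.ofReal (profileSeries β b θ w x)
      = ∑' n, ENNReal.ofReal (w n / θ ^ n)
        * ENNReal.ofReal (x ^ (s - 1) * profile β (b * θ ^ n * x)) := by
    intro x hx
    have hx0 : (0 : ℝ) < x := hx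
    rw [profileSeries, ENNReal.ofReal_tsum_of_nonneg
      (fun n => mul_nonneg (h0 n) (profile_nonneg _ _)) (summable_profileSeries hβ hθ hw x),
      ← ENNReal.tsum_mul_left]
    refine tsum_congr fun n => ?_
    rw [ENNReal.ofReal_mul (h0 n), ENNReal.ofReal_mul (Real.rpow_nonneg hx0.le _)]
    ring
  have hm : ∀ n : ℕ, Measurable fun x => ENNReal.ofReal (w n / θ ^ n)
      * ENNReal.ofReal (x ^ (s - 1) * profile β (b * θ ^ n * x)) := fun n =>
    ((measurable_id.pow_const (s - 1)).mul ((continuous_profile hβ).measurable.comp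
      (measurable_id.const_mul (b * θ ^ n)))).ennreal_ofReal.const_mul _
  rw [setLIntegral_congr_fun measurableSet_Ioi e1, lintegral_tsum fun n => (hm n).aemeasurable,
    ← tsum_mul_left, ENNReal.ofReal_tsum_of_nonneg
    (fun n => mul_nonneg hM.le (mul_nonneg (hw0 n) (by positivity))) (hsum.mul_left _)]
  refine tsum_congr fun n => ?_
  rw [lintegral_const_mul' _ _ ENNReal.ofReal_ne_top,
    lintegral_rpow_mul_profile hβ hs (by positivity), ← ENNReal.ofReal_mul (h0 n)]
  congr 1
  have e2 : (b * θ ^ n) ^ (-s) = b ^ (-s) * (θ ^ (-s)) ^ n := by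
    rw [Real.mul_rpow hb.le (by positivity), ← Real.rpow_natCast, ← Real.rpow_mul hθ0.le,
      ← Real.rpow_natCast, ← Real.rpow_mul hθ0.le, mul_comm (n : ℝ)]
  have e3 : θ ^ (-1 - s) = θ⁻¹ * θ ^ (-s) := by
    rw [sub_eq_add_neg, Real.rpow_add hθ0, Real.rpow_neg_one]
  rw [e2, e3, profileMoment, mul_pow, inv_pow]
  ring

theorem profileMoment_le (hβ : 0 < β) (hβ2 : β ≤ 2) (hb : 0 < b) {c : ℝ} (hc : 0 < c)
    (hbc : b ^ β * β ^ 2 = c) (k : ℕ) :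
    profileMoment β b (1 + k * β) ≤ profileMoment β b 1 * (1 / c) ^ k * (2 * k).factorial := by
  induction k with
  | zero => simp
  | succ k ih =>
    have hs : 0 < 1 + (k : ℝ) * β := by positivity
    have hrec := profileMoment_add hβ hb hs hbc
    have hfac : ((2 * (k + 1)).factorial : ℝ) = (2 * k + 2) * (2 * k + 1) * (2 * k).factorial := by
      rw [show 2 * (k + 1) = 2 * k + 1 + 1 by ring, Nat.factorial_succ, Nat.factorial_succ]
      push_cast; ring
    have hkβ : (k : ℝ) * β ≤ 2 * k := by nlinarith [Nat.cast_nonneg (α := ℝ) k]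
    have hM := profileMoment_pos hβ hb hs
    have h1 : (1 + k * β) * (1 + k * β + 1) * profileMoment β b (1 + k * β)
        ≤ (2 * k + 1) * (2 * k + 2)
          * (profileMoment β b 1 * (1 / c) ^ k * (2 * k).factorial) := by
      refine mul_le_mul (mul_le_mul (by linarith) (by linarith) (by linarith) (by positivity)) ih
        hM.le (by positivity)
    have h2 : profileMoment β b (1 + ((k + 1 : ℕ) : ℝ) * β)
        = (1 + k * β) * (1 + k * β + 1) * profileMoment β b (1 + k * β) / c := by
      rw [eq_div_iff hc.ne', ← hrec]; push_cast; ring_nf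
    rw [h2, div_le_iff₀ hc, hfac]
    refine h1.trans (le_of_eq ?_)
    rw [pow_succ]
    field_simp

end

namespace IsHalfLineSolution

variable {c α θ b : ℝ} {p : ℝ → ℝ}

theorem moment_eq_profileMoment (h : IsHalfLineSolution c α θ p) (hc : 0 < c) (hθ : 1 < θ)
    (hα0 : 0 ≤ α) (hα2 : α < 2) (hb : 0 < b) (hbc : b ^ (2 - α) * (2 - α) ^ 2 = c) {A : ℝ}
    (hA1 : ∫ x in Ioi 0, p x = A * (profileMoment (2 - α) b 1 * genFun θ α (θ ^ (-2 : ℝ))))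
    (k : ℕ) :
    ∫⁻ x in Ioi (0 : ℝ), ENNReal.ofReal (x ^ (1 + k * (2 - α) - 1)) * ENNReal.ofReal (p x)
      = ENNReal.ofReal (A * (profileMoment (2 - α) b (1 + k * (2 - α))
        * genFun θ α (θ ^ (-1 - (1 + k * (2 - α)))))) := by
  have hθ0 : 0 < θ := by linarith
  have hβ : 0 < 2 - α := by linarith
  induction k with
  | zero =>
    simp only [Nat.cast_zero, zero_mul, add_zero, sub_self, Real.rpow_zero, ENNReal.ofReal_one,
      one_mul]
    rw [← ofReal_integral_eq_lintegral_ofReal h.integrable.integrableOn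
      (ae_of_all _ h.nonneg), hA1]
    norm_num
  | succ k ih =>
    set s : ℝ := 1 + k * (2 - α) with hs
    have hs0 : 0 < s := by positivity
    have hs1 : 1 + ((k + 1 : ℕ) : ℝ) * (2 - α) = s + (2 - α) := by push_cast; ring
    have hlt : θ ^ (-1 - s) < 1 := Real.rpow_lt_one_of_one_lt_of_neg hθ (by linarith)
    have hκ : 0 < c * (1 - θ ^ (-1 - s)) / (s * (s + 1)) :=
      div_pos (mul_pos hc (by linarith)) (by positivity)
    rw [hs1]
    have hrec := h.moment_eq hc hθ hα0 hs0
    rw [ih] at hrec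
    refine ((ENNReal.mul_right_inj (ENNReal.ofReal_pos.2 hκ).ne' ENNReal.ofReal_ne_top).1 ?_)
    rw [← hrec, ← ENNReal.ofReal_mul hκ.le]
    congr 1
    have hg := genFun_mul hθ hα2 (z := θ ^ (-1 - (s + (2 - α)))) (Real.rpow_pos_of_pos hθ0 _)
    rw [← Real.rpow_add hθ0, show 2 - α + (-1 - (s + (2 - α))) = -1 - s by ring] at hg
    have hm := profileMoment_add hβ hb hs0 hbc
    rw [hg]
    field_simp
    linear_combination -(A * (1 - θ ^ (-1 - s)) * genFun θ α (θ ^ (-1 - (s + (2 - α))))) * hm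

/-- A solution on the half-line is a multiple of the Bessel series. -/
theorem eq_mul_profileSeries (h : IsHalfLineSolution c α θ p) (hc : 0 < c) (hθ : 1 < θ)
    (hα0 : 0 ≤ α) (hα2 : α < 2) (hb : 0 < b) (hbc : b ^ (2 - α) * (2 - α) ^ 2 = c) {A : ℝ}
    (hA : 0 ≤ A)
    (hA1 : ∫ x in Ioi 0, p x = A * (profileMoment (2 - α) b 1 * genFun θ α (θ ^ (-2 : ℝ))))
    {x : ℝ} (hx : 0 < x) : p x = A * profileSeries (2 - α) b θ (coeff θ α) x := by
  have hθ0 : 0 < θ := by linarith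
  have hβ : 0 < 2 - α := by linarith
  set β := 2 - α
  set w₁ : ℕ → ℝ := fun n => max (coeff θ α n) 0 with hw₁
  set w₂ : ℕ → ℝ := fun n => max (-coeff θ α n) 0 with hw₂
  have hw₁0 : ∀ n, 0 ≤ w₁ n := fun n => le_max_right _ _
  have hw₂0 : ∀ n, 0 ≤ w₂ n := fun n => le_max_right _ _
  have hw₁s : ∀ r : ℝ, 0 < r → Summable fun n => |w₁ n| * r ^ n := fun r hr =>
    Summable.of_nonneg_of_le (fun n => by positivity) (fun n => mul_le_mul_of_nonneg_right
      ((abs_of_nonneg (hw₁0 n)).trans_le (max_le (le_abs_self _) (abs_nonneg _))) (by positivity))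
      (summable_abs_coeff_mul_pow hθ hα2 hr)
  have hw₂s : ∀ r : ℝ, 0 < r → Summable fun n => |w₂ n| * r ^ n := fun r hr =>
    Summable.of_nonneg_of_le (fun n => by positivity) (fun n => mul_le_mul_of_nonneg_right
      ((abs_of_nonneg (hw₂0 n)).trans_le (max_le (neg_le_abs _) (abs_nonneg _))) (by positivity))
      (summable_abs_coeff_mul_pow hθ hα2 hr)
  have hsub : ∀ n, coeff θ α n = w₁ n - w₂ n := fun n => by
    rw [hw₁, hw₂]
    rcases le_total 0 (coeff θ α n) with hn | hn
    · simp [hn]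
    · simp [hn]
  have hF : ∀ y, profileSeries β b θ (coeff θ α) y
      = profileSeries β b θ w₁ y - profileSeries β b θ w₂ y := fun y => by
    rw [profileSeries, profileSeries, profileSeries,
      ← (summable_profileSeries hβ hθ hw₁s y).tsum_sub (summable_profileSeries hβ hθ hw₂s y)]
    refine tsum_congr fun n => ?_
    rw [hsub]; ring
  have hF₁0 := fun y => profileSeries_nonneg (β := β) (b := b) hθ hw₁0 y
  have hF₂0 := fun y => profileSeries_nonneg (β := β) (b := b) hθ hw₂0 y
  have hF₁c := continuous_profileSeries (b := b) hβ hθ hw₁s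
  have hF₂c := continuous_profileSeries (b := b) hβ hθ hw₂s
  have hs₁ : ∀ r : ℝ, 0 < r → Summable fun n => w₁ n * r ^ n := fun r hr => by
    simpa [abs_of_nonneg (hw₁0 _)] using hw₁s r hr
  have hs₂ : ∀ r : ℝ, 0 < r → Summable fun n => w₂ n * r ^ n := fun r hr => by
    simpa [abs_of_nonneg (hw₂0 _)] using hw₂s r hr
  have hg : ∀ r : ℝ, 0 < r → genFun θ α r = (∑' n, w₁ n * r ^ n) - ∑' n, w₂ n * r ^ n :=
    fun r hr => by
      rw [genFun, ← (hs₁ r hr).tsum_sub (hs₂ r hr)]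
      refine tsum_congr fun n => ?_
      rw [hsub]; ring
  set f₁ : ℝ → ENNReal := fun y => ENNReal.ofReal A * ENNReal.ofReal (profileSeries β b θ w₁ y)
    with hf₁
  set f₂ : ℝ → ENNReal := fun y =>
    ENNReal.ofReal (p y) + ENNReal.ofReal A * ENNReal.ofReal (profileSeries β b θ w₂ y) with hf₂
  have hf₁m : Measurable f₁ := hF₁c.measurable.ennreal_ofReal.const_mul _
  have hf₂m : Measurable f₂ := h.continuous.measurable.ennreal_ofReal.add
    (hF₂c.measurable.ennreal_ofReal.const_mul _)
  have hpm : Measurable fun y => ENNReal.ofReal (p y) := h.continuous.measurable.ennreal_ofReal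
  have hs0 : ∀ k : ℕ, 0 < 1 + (k : ℝ) * β := fun k => by positivity
  have hmom₁ : ∀ k : ℕ, ∫⁻ y in Ioi 0, ENNReal.ofReal (y ^ (k * β)) ∂volume.withDensity f₁
      = ENNReal.ofReal (A * (profileMoment β b (1 + k * β)
        * ∑' n, w₁ n * (θ ^ (-1 - (1 + k * β))) ^ n)) := by
    intro k
    rw [setLIntegral_withDensity_eq_setLIntegral_mul _ hf₁m (by fun_prop) measurableSet_Ioi,
      ENNReal.ofReal_mul hA, ← lintegral_rpow_mul_profileSeries hβ hb hθ hw₁0 hw₁s (hs0 k),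
      ← lintegral_const_mul' _ _ ENNReal.ofReal_ne_top]
    refine lintegral_congr fun y => ?_
    rw [Pi.mul_apply, hf₁, add_sub_cancel_left]
    ring
  have hmom₂ : ∀ k : ℕ, ∫⁻ y in Ioi 0, ENNReal.ofReal (y ^ (k * β)) ∂volume.withDensity f₂
      = ENNReal.ofReal (A * (profileMoment β b (1 + k * β)
        * ∑' n, w₁ n * (θ ^ (-1 - (1 + k * β))) ^ n)) := by
    intro k
    have hr : 0 < θ ^ (-1 - (1 + (k : ℝ) * β)) := Real.rpow_pos_of_pos hθ0 _
    have hr1 : θ ^ (-1 - (1 + (k : ℝ) * β)) < 1 :=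
      Real.rpow_lt_one_of_one_lt_of_neg hθ (by linarith [hs0 k])
    have hM := profileMoment_pos hβ hb (hs0 k)
    have hgp := genFun_pos hθ hα2 hr hr1
    have h2 : 0 ≤ ∑' n, w₂ n * (θ ^ (-1 - (1 + (k : ℝ) * β))) ^ n :=
      tsum_nonneg fun n => mul_nonneg (hw₂0 n) (by positivity)
    have hsplit : A * (profileMoment β b (1 + k * β) * ∑' n, w₁ n * (θ ^ (-1 - (1 + k * β))) ^ n)
        = A * (profileMoment β b (1 + k * β) * genFun θ α (θ ^ (-1 - (1 + k * β))))
          + A * (profileMoment β b (1 + k * β)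
            * ∑' n, w₂ n * (θ ^ (-1 - (1 + k * β))) ^ n) := by
      rw [hg _ hr]; ring
    rw [hsplit, ENNReal.ofReal_add (by positivity) (by positivity),
      ← h.moment_eq_profileMoment hc hθ hα0 hα2 hb hbc hA1 k, ENNReal.ofReal_mul hA,
      ← lintegral_rpow_mul_profileSeries hβ hb hθ hw₂0 hw₂s (hs0 k),
      ← lintegral_const_mul' _ _ ENNReal.ofReal_ne_top, ← lintegral_add_left (by fun_prop),
      setLIntegral_withDensity_eq_setLIntegral_mul _ hf₂m (by fun_prop) measurableSet_Ioi]
    refine lintegral_congr fun y => ?_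
    rw [Pi.mul_apply, hf₂, add_sub_cancel_left]
    ring
  have hres := restrict_Ioi_eq_of_moments (μ := volume.withDensity f₁)
    (ν := volume.withDensity f₂) (R := 1 / c)
    (C := A * (profileMoment β b 1 * ∑' n, w₁ n * (θ ^ (-2 : ℝ)) ^ n)) hβ (by positivity)
    (fun k => (hmom₁ k).trans (hmom₂ k).symm) fun k => by
      rw [hmom₁]
      refine ENNReal.ofReal_le_ofReal ?_
      have hle : ∑' n, w₁ n * (θ ^ (-1 - (1 + (k : ℝ) * β))) ^ n
          ≤ ∑' n, w₁ n * (θ ^ (-2 : ℝ)) ^ n := by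
        refine (hs₁ _ (Real.rpow_pos_of_pos hθ0 _)).tsum_le_tsum (fun n => ?_)
          (hs₁ _ (Real.rpow_pos_of_pos hθ0 _))
        refine mul_le_mul_of_nonneg_left (pow_le_pow_left₀ (by positivity) ?_ n) (hw₁0 n)
        refine Real.rpow_le_rpow_of_exponent_le hθ.le ?_
        have : 0 ≤ (k : ℝ) * β := by positivity
        linarith
      have h0 : 0 ≤ ∑' n, w₁ n * (θ ^ (-1 - (1 + (k : ℝ) * β))) ^ n :=
        tsum_nonneg fun n => mul_nonneg (hw₁0 n) (by positivity)
      have hM := profileMoment_pos hβ hb (one_pos (α := ℝ))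
      calc _ ≤ A * (profileMoment β b 1 * (1 / c) ^ k * (2 * k).factorial
            * ∑' n, w₁ n * (θ ^ (-2 : ℝ)) ^ n) :=
            mul_le_mul_of_nonneg_left (mul_le_mul
              (profileMoment_le hβ (by linarith) hb hc hbc k) hle h0 (by positivity)) hA
        _ = _ := by ring
  rw [restrict_withDensity measurableSet_Ioi, restrict_withDensity measurableSet_Ioi,
    withDensity_eq_iff_of_sigmaFinite hf₁m.aemeasurable hf₂m.aemeasurable] at hres
  have hres' : (fun y => A * profileSeries β b θ w₁ y) =ᵐ[volume.restrict (Ioi 0)]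
      fun y => p y + A * profileSeries β b θ w₂ y := by
    filter_upwards [hres] with y hy
    simp only [hf₁, hf₂] at hy
    rw [← ENNReal.ofReal_mul hA, ← ENNReal.ofReal_mul hA,
      ← ENNReal.ofReal_add (h.nonneg y) (mul_nonneg hA (hF₂0 y)),
      ENNReal.ofReal_eq_ofReal_iff (mul_nonneg hA (hF₁0 y))
        (add_nonneg (h.nonneg y) (mul_nonneg hA (hF₂0 y)))] at hy
    exact hy
  have := Measure.eqOn_open_of_ae_eq hres' isOpen_Ioi (continuous_const.mul hF₁c).continuousOn
    (h.continuous.add (continuous_const.mul hF₂c)).continuousOn hx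
  simp only at this
  rw [hF, mul_sub]
  linarith

end IsHalfLineSolution

theorem isHalfLineSolution_of_solvesStationaryODE {σ lam θ α : ℝ} {p : ℝ → ℝ} (hσ : σ ≠ 0)
    (hθ : 1 < θ) (hdens : IsDensity p) (hcont : Continuous p) (hC2 : ContDiffOn ℝ 2 p {0}ᶜ)
    (hode : SolvesStationaryODE σ 0 θ (powerLawRate lam α) p) :
    IsHalfLineSolution (2 * lam / σ ^ 2) α θ p where
  nonneg := hdens.nonneg
  integrable := hdens.integrable
  continuous := hcont
  contDiffOn := hC2.mono fun x hx => ne_of_gt hx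
  deriv_deriv x hx := by
    have hθx : 0 < θ * x := by nlinarith
    have h := hode x hx.ne'
    rw [powerLawRate, powerLawRate, abs_of_pos hx, abs_of_pos hθx, div_eq_mul_inv lam,
      div_eq_mul_inv lam, ← Real.rpow_neg hx.le, ← Real.rpow_neg hθx.le] at h
    field_simp
    linarith

theorem SolvesStationaryODE.comp_neg {σ lam θ α : ℝ} {p : ℝ → ℝ}
    (hode : SolvesStationaryODE σ 0 θ (powerLawRate lam α) p) :
    SolvesStationaryODE σ 0 θ (powerLawRate lam α) fun x => p (-x) := by
  intro x hx
  have h1 : deriv (fun x => p (-x)) = fun x => -deriv p (-x) := funext fun x => deriv_comp_neg p x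
  have h2 : deriv (deriv fun x => p (-x)) x = deriv (deriv p) (-x) := by
    rw [h1, deriv.fun_neg, deriv_comp_neg (deriv p), neg_neg]
  have h := hode (-x) (neg_ne_zero.2 hx)
  rw [h2]
  simp only [powerLawRate, mul_neg, abs_neg, mul_zero, zero_mul, sub_zero] at h ⊢
  exact h

theorem IsDensity.comp_neg {p : ℝ → ℝ} (h : IsDensity p) : IsDensity fun x => p (-x) where
  nonneg x := h.nonneg (-x)
  integrable := h.integrable.comp_neg
  integral_eq_one := by rw [integral_neg_eq_self p]; exact h.integral_eq_one

theorem profileSeries_zero_pos {θ α b : ℝ} (hθ : 1 < θ) (hα2 : α < 2) :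
    0 < profileSeries (2 - α) b θ (coeff θ α) 0 := by
  have hβ : 0 < 2 - α := by linarith
  have hθ0 : 0 < θ := by linarith
  have h : profileSeries (2 - α) b θ (coeff θ α) 0
      = genFun θ α θ⁻¹ * (1 / 2 * Real.Gamma (1 / (2 - α))) := by
    rw [profileSeries, genFun, ← tsum_mul_right]
    refine tsum_congr fun n => ?_
    rw [mul_zero, profile_zero hβ, inv_pow, div_eq_mul_inv]
  have hΓ : 0 < Real.Gamma (1 / (2 - α)) := Real.Gamma_pos_of_pos (by positivity)
  have := genFun_pos hθ hα2 (inv_pos.2 hθ0) (inv_lt_one_of_one_lt₀ hθ)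
  rw [h]
  positivity

end WeakConsensus

open WeakConsensus MeasureTheory Set Filter Topology

theorem mainTheorem1 (σ lam θ α : ℝ) (hσ : σ ≠ 0) (hlam : 0 < lam) (hθ : 1 < θ)
    (hα0 : 0 ≤ α) (hα2 : α < 2) (p : ℝ → ℝ)
    (hdens : WeakConsensus.IsDensity p)
    (hcont : Continuous p) (hC2 : ContDiffOn ℝ 2 p {0}ᶜ)
    (hode : WeakConsensus.SolvesStationaryODE σ 0 θ (WeakConsensus.powerLawRate lam α) p) :
    ∀ x : ℝ, x ≠ 0 →
      Summable (WeakConsensus.seriesTerm σ lam θ α x) ∧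
      p x = 2 * WeakConsensus.normConst σ lam θ α * (2 - α)
        * ∑' n : ℕ, WeakConsensus.seriesTerm σ lam θ α x n := by
  have hβ : 0 < 2 - α := by linarith
  have hθ0 : 0 < θ := by linarith
  have hc : 0 < 2 * lam / σ ^ 2 := by positivity
  set b : ℝ := (2 * lam / (σ ^ 2 * (2 - α) ^ 2)) ^ (1 / (2 - α)) with hb_def
  have hb : 0 < b := by positivity
  have hbc : b ^ (2 - α) * (2 - α) ^ 2 = 2 * lam / σ ^ 2 := by
    rw [hb_def, ← Real.rpow_mul (by positivity), one_div_mul_cancel hβ.ne', Real.rpow_one]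
    field_simp
  have hsol := isHalfLineSolution_of_solvesStationaryODE hσ hθ hdens hcont hC2 hode
  have hsol' : IsHalfLineSolution (2 * lam / σ ^ 2) α θ fun x => p (-x) :=
    isHalfLineSolution_of_solvesStationaryODE hσ hθ hdens.comp_neg (hcont.comp continuous_neg)
      (hC2.comp contDiff_neg.contDiffOn fun x hx => neg_ne_zero.2 hx) hode.comp_neg
  set F : ℝ → ℝ := profileSeries (2 - α) b θ (coeff θ α) with hF
  have hFc : Continuous F :=
    continuous_profileSeries hβ hθ fun r hr => summable_abs_coeff_mul_pow hθ hα2 hr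
  have hF0 : 0 < F 0 := profileSeries_zero_pos hθ hα2
  set T : ℝ := profileMoment (2 - α) b 1 * genFun θ α (θ ^ (-2 : ℝ)) with hT
  have hg : 0 < genFun θ α (θ ^ (-2 : ℝ)) := genFun_pos hθ hα2 (Real.rpow_pos_of_pos hθ0 _)
    (Real.rpow_lt_one_of_one_lt_of_neg hθ (by norm_num))
  have hT0 : 0 < T := mul_pos (profileMoment_pos hβ hb one_pos) hg
  have key : ∀ f : ℝ → ℝ, IsHalfLineSolution (2 * lam / σ ^ 2) α θ f →
      (∀ x, 0 < x → f x = (∫ x in Ioi 0, f x) / T * F x)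
        ∧ f 0 = (∫ x in Ioi 0, f x) / T * F 0 := by
    intro f hf
    have h1 : ∀ x, 0 < x → f x = (∫ x in Ioi 0, f x) / T * F x := fun x hx =>
      hf.eq_mul_profileSeries hc hθ hα0 hα2 hb hbc
        (div_nonneg (integral_nonneg hf.nonneg) hT0.le) (div_mul_cancel₀ _ hT0.ne').symm hx
    refine ⟨h1, tendsto_nhds_unique
      (hf.continuous.continuousAt.tendsto.mono_left (nhdsWithin_le_nhds (s := Ioi 0))) ?_⟩
    refine (((continuous_const.mul hFc).continuousAt (x := 0)).tendsto.mono_left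
      (nhdsWithin_le_nhds (s := Ioi 0))).congr' ?_
    filter_upwards [self_mem_nhdsWithin] with x hx using (h1 x hx).symm
  obtain ⟨hpos, hpos0⟩ := key p hsol
  obtain ⟨hneg, hneg0⟩ := key _ hsol'
  have hhalf : (∫ x in Ioi 0, p x) + ∫ x in Ioi 0, p (-x) = 1 := by
    rw [integral_comp_neg_Ioi, neg_zero, add_comm, ← hdens.integral_eq_one]
    exact intervalIntegral.integral_Iic_add_Ioi hdens.integrable.integrableOn
      hdens.integrable.integrableOn
  have heq : (∫ x in Ioi 0, p x) = ∫ x in Ioi 0, p (-x) := by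
    rw [neg_zero, hpos0] at hneg0
    field_simp at hneg0
    exact hneg0
  have hm : (∫ x in Ioi 0, p x) = 1 / 2 := by linarith
  have hm' : (∫ x in Ioi 0, p (-x)) = 1 / 2 := by linarith
  have habs : ∀ x, x ≠ 0 → p x = 1 / 2 / T * F |x| := by
    intro x hx
    rcases lt_or_gt_of_ne hx with hx | hx
    · have := hneg (-x) (neg_pos.2 hx)
      rwa [neg_neg, hm', ← abs_of_neg hx] at this
    · have := hpos x hx
      rw [hm] at this
      rwa [abs_of_pos hx]
  have hconst : 2 * normConst σ lam θ α * (2 - α) = 1 / 2 / T := by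
    have h1 : 0 < Real.Gamma (1 / (2 - α)) := Real.Gamma_pos_of_pos (by positivity)
    have h2 : 0 < Real.Gamma (2 / (2 - α)) := Real.Gamma_pos_of_pos (by positivity)
    rw [normConst, tprod_eq_genFun hθ hα2, ← hb_def, hT, profileMoment, Real.rpow_neg_one,
      one_add_one_eq_two]
    field_simp
  intro x hx
  have hterm : seriesTerm σ lam θ α x
      = fun n => coeff θ α n / θ ^ n * profile (2 - α) (b * θ ^ n * |x|) :=
    funext fun n => seriesTerm_eq hσ hlam hθ hα2 hx n
  rw [hterm]
  exact ⟨summable_profileSeries hβ hθ (fun r hr => summable_abs_coeff_mul_pow hθ hα2 hr) |x|, by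
    rw [hconst, habs x hx, hF, profileSeries]⟩
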